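/- Assume, as a standing set-theoretic hypothesis, that the (strongly) inaccessible cardinals are unbounded among all cardinals. Let $L$ be a countable first-order language. A \emph{map} $f:M\to N$ between $L$-structures is a partial injective function from $M$ to $N$, taken together with $M$ and $N$; $\operatorname{dom} f\subseteq M$ is its domain of definition, $|f|$ is the cardinality of $\operatorname{dom} f$, and $f$ is \emph{total} if $\operatorname{dom} f=M$. It is a \emph{partial embedding} if it preserves and reflects all quantifier-free formulas on tuples of $\operatorname{dom} f$, and an \emph{elementary map} if it does so for all formulas. An \emph{inductive amalgamation class} $\mathcal K$ is a category whose objects, called \emph{models}, are infinite $L$-structures, and whose morphisms are partial embeddings between models, composed as partial maps, such that: (K0) every structure elementarily equivalent to a model is a model; (K1) all elementary maps between models are morphisms; (K2) if $f:M\to N$ is a morphism, so is the inverse map $f^{-1}:N\to M$; (R) if $h:M\to N$ is a morphism and $f\subseteq h$, then $f:M\to N$ is a morphism; (Ap) for every morphism $f:M\to N$ there are a model $N'$ with $N\le N'$ and a total morphism $h:M\to N'$ with $f\subseteq h$; (In) the union $M$ of a nonempty chain of models $\langle M_i:i<\alpha\rangle$ with $M_i\le M_j$ for $i<j$ is a model,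 and $M_i\le M$ for all $i$. Here $M\le N$ means that $M$ is a substructure of $N$ and $\mathrm{id}_M:M\to N$ is a morphism. For an infinite cardinal $\lambda$, a model $U$ is \emph{$\lambda$-rich} if every morphism $f:M\to U$ with $|f|<|M|\le\lambda$ extends to a total morphism $h:M\to U$; $U$ is \emph{rich} if it is $|U|$-rich. A structure $M$ is \emph{$\lambda$-saturated} if every type in finitely many variables over fewer than $\lambda$ parameters that is finitely satisfiable in $M$ is realized in $M$, and \emph{saturated} if it is $|M|$-saturated. Let $\mathcal K$ be an inductive amalgamation class and let $\lambda$ be any infinite cardinal. The following are equivalent: 1. all $\lambda$-rich models are $\lambda$-saturated; 2. all rich models are saturated; 3. if $U$ is rich, $M\equiv U$ and $M\le U$, then $M\preceq U$; 4. if $U$ is rich and $M\equiv U$, then every morphism $f:M\to U$ is an elementary map. -/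

import Mathlib

open FirstOrder Cardinal

universe u

namespace AmalgamationClasses

section Maps

variable (L : FirstOrder.Language.{0, 0}) {M N : Type u} [L.Structure M] [L.Structure N]

/-- A map `f : M → N` in the sense of partial injective functions is a `PEquiv`: `b ∈ f a` says
that `f` is defined at `a` with value `b`.  `f.symm` is the inverse map, `PEquiv.trans` is
composition, and `f ≤ g` is inclusion of graphs.  `dom f` is the domain of definition. -/
def dom {M N : Type u} (f : M ≃. N) : Set M := {a | ∃ b, b ∈ f a}

/-- The map is defined on the whole of `M`. -/
def IsTotal {M N : Type u} (f : M ≃. N) : Prop := ∀ a, ∃ b, b ∈ f a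

/-- Partial embeddings preserve and reflect quantifier-free formulas on their domain. -/
def IsPartialEmbedding (f : M ≃. N) : Prop :=
  ∀ (n : ℕ) (φ : L.Formula (Fin n)), FirstOrder.Language.BoundedFormula.IsQF φ →
    ∀ (a : Fin n → M) (b : Fin n → N), (∀ i, b i ∈ f (a i)) → (φ.Realize a ↔ φ.Realize b)

/-- Elementary maps preserve and reflect all formulas on their domain.  The case `n = 0` says
that `M` and `N` are elementarily equivalent. -/
def IsElementaryMap (f : M ≃. N) : Prop :=
  ∀ (n : ℕ) (φ : L.Formula (Fin n)) (a : Fin n → M) (b : Fin n → N),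
    (∀ i, b i ∈ f (a i)) → (φ.Realize a ↔ φ.Realize b)

open Classical in
/-- A total injective function regarded as a map. -/
noncomputable def ofInjective {M N : Type u} (e : M ↪ N) : M ≃. N where
  toFun a := some (e a)
  invFun b := if h : ∃ a, e a = b then some h.choose else none
  inv a b := by
    constructor
    · intro h
      split_ifs at h with hb
      · rw [← Option.some.inj h, hb.choose_spec]
    · intro h
      have hb : ∃ a, e a = b := ⟨a, Option.some.inj h⟩
      rw [dif_pos hb]
      exact congrArg some (e.injective (hb.choose_spec.trans (Option.some.inj h).symm))

theorem mem_ofInjective {M N : Type u} (e : M ↪ N) (a : M) (b : N) :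
    b ∈ ofInjective e a ↔ e a = b := by
  change some (e a) = some b ↔ _
  simp

/-- `M` is `κ`-saturated: every type in finitely many variables over a set of fewer than `κ`
parameters (a set of formulas that is finitely satisfiable in `M`) is realized in `M`. -/
def IsSaturated (κ : Cardinal.{u}) (M : Type u) [L.Structure M] : Prop :=
  ∀ A : Set M, #A < κ → ∀ (n : ℕ) (p : Set (L[[A]].Formula (Fin n))),
    (∀ q : Set (L[[A]].Formula (Fin n)), q ⊆ p → q.Finite →
      ∃ v : Fin n → M, ∀ φ ∈ q, φ.Realize v) →
    ∃ v : Fin n → M, ∀ φ ∈ p, φ.Realize v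

end Maps

/-- An inductive amalgamation class of `L`-structures: a category of infinite structures and
partial embeddings (composed as maps), satisfying the axioms below. -/
structure InductiveAmalgamationClass (L : FirstOrder.Language.{0, 0}) where
  /-- The objects, called models. -/
  IsModel : ∀ (M : Type u) [L.Structure M], Prop
  /-- The morphisms. -/
  IsMorphism : ∀ {M N : Type u} [L.Structure M] [L.Structure N], (M ≃. N) → Prop
  infinite : ∀ {M : Type u} [L.Structure M], IsModel M → Infinite M
  isModel_dom : ∀ {M N : Type u} [L.Structure M] [L.Structure N] {f : M ≃. N},
    IsMorphism f → IsModel M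
  isModel_cod : ∀ {M N : Type u} [L.Structure M] [L.Structure N] {f : M ≃. N},
    IsMorphism f → IsModel N
  isPartialEmbedding : ∀ {M N : Type u} [L.Structure M] [L.Structure N] {f : M ≃. N},
    IsMorphism f → IsPartialEmbedding L f
  id : ∀ {M : Type u} [L.Structure M], IsModel M → IsMorphism (PEquiv.refl M)
  comp : ∀ {M N P : Type u} [L.Structure M] [L.Structure N] [L.Structure P]
    {f : M ≃. N} {g : N ≃. P}, IsMorphism f → IsMorphism g → IsMorphism (f.trans g)
  /-- K0: models are closed under elementary equivalence. -/
  elementarilyEquivalent : ∀ {M N : Type u} [L.Structure M] [L.Structure N],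
    IsModel M → (M ≅[L] N) → IsModel N
  /-- K1: elementary maps between models are morphisms. -/
  elementary : ∀ {M N : Type u} [L.Structure M] [L.Structure N] {f : M ≃. N},
    IsModel M → IsModel N → IsElementaryMap L f → IsMorphism f
  /-- K2: the inverse of a morphism is a morphism. -/
  inverse : ∀ {M N : Type u} [L.Structure M] [L.Structure N] {f : M ≃. N},
    IsMorphism f → IsMorphism f.symm
  /-- R: restrictions of morphisms are morphisms. -/
  restrict : ∀ {M N : Type u} [L.Structure M] [L.Structure N] {f h : M ≃. N},
    IsMorphism h → f ≤ h → IsMorphism f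
  /-- Ap: every morphism `f : M → N` extends to a total morphism `h : M → N'` with `N ≤ N'`.  The
  strong extension `N ≤ N'` is given by a strong embedding `e : N → N'`, that is, up to
  identifying `N` with its image. -/
  amalgamation : ∀ {M N : Type u} [L.Structure M] [L.Structure N] {f : M ≃. N},
    IsMorphism f → ∃ (N' : Type u) (_ : L.Structure N') (e : N ≃. N') (h : M ≃. N'),
      IsMorphism e ∧ IsTotal e ∧ IsMorphism h ∧ IsTotal h ∧ f.trans e ≤ h
  /-- In: the union `M` of a (nonempty, well-ordered) chain of models `S i` with `S i ≤ S j` for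
  `i < j` is a model, and `S i ≤ M` for all `i`. -/
  chain : ∀ {ι : Type u} [LinearOrder ι] [WellFoundedLT ι] [Nonempty ι]
    {M : Type u} [L.Structure M] (S : ι → L.Substructure M) (hS : Monotone S),
    (∀ i, IsModel (S i)) →
    (∀ i j (hij : i < j),
      IsMorphism (ofInjective (Language.Substructure.inclusion (hS hij.le)).toEmbedding)) →
    (∀ x : M, ∃ i, x ∈ S i) →
    IsModel M ∧ ∀ i, IsMorphism (ofInjective (S i).subtype.toEmbedding)

namespace InductiveAmalgamationClass

variable {L : FirstOrder.Language.{0, 0}} (K : InductiveAmalgamationClass.{u} L)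

/-- `S ≤ N`: the substructure `S` of `N` is a strong submodel, i.e. the inclusion is a morphism. -/
def IsStrongSubmodel {N : Type u} [L.Structure N] (S : L.Substructure N) : Prop :=
  K.IsMorphism (ofInjective S.subtype.toEmbedding)

/-- `U` is a `κ`-rich model: every morphism `f : M → U` with `|f| < |M| ≤ κ` extends to a total
morphism `h : M → U`. -/
def IsCardinalRich (κ : Cardinal.{u}) (U : Type u) [L.Structure U] : Prop :=
  K.IsModel U ∧ ∀ (M : Type u) [L.Structure M] (f : M ≃. U), K.IsMorphism f →
    #(dom f) < #M → #M ≤ κ → ∃ h : M ≃. U, K.IsMorphism h ∧ IsTotal h ∧ f ≤ h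

/-- `U` is a rich model: it is `|U|`-rich. -/
def IsRich (U : Type u) [L.Structure U] : Prop := K.IsCardinalRich #U U

end InductiveAmalgamationClass

end AmalgamationClasses

open AmalgamationClasses

/-! Condition 4 is the hub. The basic tool is a back-and-forth argument: a finite morphism between
`ℵ₀`-rich models extends to any further element on either side, so morphisms between rich models are
elementary (`isElementaryMap_of_rich`).

Rich models must also be plentiful. For inaccessible `θ`, a chain of length `θ` of models of size
below `θ`, each handling all extension problems over the previous one, has a union that absorbs
every morphism from a model of size below `θ` (`exists_extension_of_isInaccessible`). Passing from
size below `θ` to size `θ` means extending a map one element at a time, and limit stages need finite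
character of morphisms. This holds because a map all of whose finite restrictions are morphisms
becomes elementary between `ℵ₀`-rich extensions, hence is a morphism by K1
(`HasRichExtensions.isMorphism_of_finite`).

From saturation to 4: a tuple `a` of `M ≡ U` has the same type as some `z` in `U`; the composite `z
↦ a ↦ f a` is a morphism from `U` to itself, hence elementary. From 4 to saturation: compactness
realizes a type over `A` in a model `M` slightly larger than `A`; richness extends the elementary
map on the copy of `A` to all of `M`, and 4 makes this extension elementary. From 3 to 4: a morphism
into `U` is amalgamated into a total one, whose image is a strong submodel of a rich elementary
extension of `U`. -/

namespace AmalgamationClasses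

/-! ### Partial embeddings and elementary maps -/

section PartialMaps

variable {L : FirstOrder.Language.{0, 0}} {M N P : Type u} [L.Structure M] [L.Structure N]
  [L.Structure P]

theorem pequiv_ext {M N : Type u} {f g : M ≃. N} (h : ∀ a b, b ∈ f a ↔ b ∈ g a) : f = g :=
  PEquiv.ext fun a => Option.ext (h a)

theorem exists_eq_ofInjective {M N : Type u} {h : M ≃. N} (ht : IsTotal h) :
    ∃ e : M ↪ N, h = ofInjective e := by
  choose e he using ht
  refine ⟨⟨e, fun a b hab => h.inj (he a) (hab ▸ he b)⟩, ?_⟩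
  ext a b
  exact ⟨fun hb => Option.mem_unique (he a) hb ▸ rfl, fun hb => by
    have := (mem_ofInjective _ a b).1 hb
    exact this ▸ he a⟩

theorem mk_dom_symm {M N : Type u} (f : M ≃. N) : #(dom f.symm) = #(dom f) := by
  refine Cardinal.mk_congr <| Equiv.symm
    { toFun := fun a => ⟨a.2.choose, a, f.mem_iff_mem.2 a.2.choose_spec⟩
      invFun := fun b => ⟨b.2.choose, b, f.mem_iff_mem.1 b.2.choose_spec⟩
      left_inv := fun a => Subtype.ext ?_
      right_inv := fun b => Subtype.ext ?_ }
  · exact f.inj (f.mem_iff_mem.1 (Exists.choose_spec (p := fun c => c ∈ f.symm a.2.choose) _))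
      a.2.choose_spec
  · exact f.symm.inj
      (f.mem_iff_mem.2 (Exists.choose_spec (p := fun c => c ∈ f b.2.choose) _)) b.2.choose_spec

theorem IsElementaryMap.symm {f : M ≃. N} (hf : IsElementaryMap L f) :
    IsElementaryMap L f.symm :=
  fun n φ a b hab => (hf n φ b a fun i => f.mem_iff_mem.1 (hab i)).symm

theorem IsElementaryMap.trans {f : M ≃. N} {g : N ≃. P} (hf : IsElementaryMap L f)
    (hg : IsElementaryMap L g) : IsElementaryMap L (f.trans g) := by
  intro n φ a b hab
  choose c hc using fun i => (PEquiv.mem_trans f g (a i) (b i)).1 (hab i)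
  exact (hf n φ a c fun i => (hc i).1).trans (hg n φ c b fun i => (hc i).2)

theorem IsElementaryMap.mono {f g : M ≃. N} (hg : IsElementaryMap L g) (hfg : f ≤ g) :
    IsElementaryMap L f :=
  fun n φ a b hab => hg n φ a b fun i => hfg _ _ (hab i)

theorem IsElementaryMap.elementarilyEquivalent {f : M ≃. N} (hf : IsElementaryMap L f) :
    M ≅[L] N := by
  rw [Language.elementarilyEquivalent_iff]
  intro φ
  have h := hf 0 (φ.relabel Empty.elim) Fin.elim0 Fin.elim0 (fun i => i.elim0)
  rw [Language.Formula.realize_relabel, Language.Formula.realize_relabel] at h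
  rw [Language.Sentence.Realize, Language.Sentence.Realize, Subsingleton.elim default,
    Subsingleton.elim (default : Empty → N)]
  exact h

theorem isElementaryMap_ofInjective (g : M ↪ₑ[L] N) :
    IsElementaryMap L (ofInjective g.toEmbedding.toEmbedding) := by
  intro n φ a b hab
  have : b = g ∘ a := funext fun i => ((mem_ofInjective _ _ _).1 (hab i)).symm
  rw [this, g.map_formula]

/-- The elementary embedding underlying a total elementary map. -/
def IsElementaryMap.toElementaryEmbedding {e : M ↪ N} (h : IsElementaryMap L (ofInjective e)) :
    M ↪ₑ[L] N where
  toFun := e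
  map_formula' n φ x := (h n φ x (e ∘ x) fun _ => rfl).symm

open Classical in
/-- The restriction of a map to a set. -/
noncomputable def restr {M N : Type u} (f : M ≃. N) (s : Set M) : M ≃. N :=
  (PEquiv.ofSet s).trans f

theorem mem_restr {M N : Type u} {f : M ≃. N} {s : Set M} {a : M} {b : N} :
    b ∈ restr f s a ↔ a ∈ s ∧ b ∈ f a := by
  classical
  rw [restr, PEquiv.mem_trans]
  constructor
  · rintro ⟨c, hc, hb⟩
    rw [PEquiv.mem_ofSet_iff] at hc
    obtain ⟨rfl, hc⟩ := hc
    exact ⟨hc, hb⟩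
  · rintro ⟨ha, hb⟩
    exact ⟨a, PEquiv.mem_ofSet_self_iff.2 ha, hb⟩

theorem restr_le {M N : Type u} (f : M ≃. N) (s : Set M) : restr f s ≤ f :=
  fun _ _ h => (mem_restr.1 h).2

theorem dom_restr_subset {M N : Type u} (f : M ≃. N) (s : Set M) : dom (restr f s) ⊆ s :=
  fun _ ⟨_, hb⟩ => (mem_restr.1 hb).1

theorem IsPartialEmbedding.realize_iff {f : M ≃. N} (hf : IsPartialEmbedding L f) {α : Type*}
    [Finite α] {φ : L.Formula α} (hφ : FirstOrder.Language.BoundedFormula.IsQF φ) {a : α → M}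
    {b : α → N} (hab : ∀ i, b i ∈ f (a i)) : φ.Realize a ↔ φ.Realize b := by
  obtain ⟨n, ⟨e⟩⟩ := Finite.exists_equiv_fin α
  have h := hf n (φ.relabel e) (by
    exact hφ.relabel _) (a ∘ e.symm) (b ∘ e.symm) (fun i => hab _)
  rw [Language.Formula.realize_relabel, Language.Formula.realize_relabel] at h
  simpa [Function.comp_assoc] using h

/-- The structure embedding underlying a total partial embedding. -/
def IsPartialEmbedding.toEmbedding {e : M ↪ N} (h : IsPartialEmbedding L (ofInjective e)) :
    M ↪[L] N where
  toFun := e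
  inj' := e.injective
  map_fun' {n} F x := by
    have := h.realize_iff (α := Option (Fin n))
      (φ := (Language.Term.func F fun i => Language.Term.var (some i)).equal
        (Language.Term.var none))
      (Language.BoundedFormula.IsAtomic.equal _ _).isQF
      (a := fun o => o.elim (Language.Structure.funMap F x) x)
      (b := fun o => e (o.elim (Language.Structure.funMap F x) x)) (fun _ => rfl)
    simpa [Language.Formula.realize_equal, eq_comm, Function.comp_def] using this
  map_rel' {n} R x := by
    have := h.realize_iff (α := Fin n) (φ := R.formula fun i => Language.Term.var i)
      (Language.BoundedFormula.IsAtomic.rel _ _).isQF (a := x) (b := e ∘ x) (fun _ => rfl)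
    simpa [Language.Formula.realize_rel, Function.comp_def] using this.symm

end PartialMaps

/-! ### Back-and-forth between rich models -/

namespace InductiveAmalgamationClass

variable {L : FirstOrder.Language.{0, 0}} (K : InductiveAmalgamationClass.{u} L)
variable {M N P : Type u} [L.Structure M] [L.Structure N] [L.Structure P]

variable {K} in
theorem IsCardinalRich.mono {κ μ : Cardinal.{u}} (h : μ ≤ κ) (hM : K.IsCardinalRich κ M) :
    K.IsCardinalRich μ M :=
  ⟨hM.1, fun N _ f hf h₁ h₂ => hM.2 N f hf h₁ (h₂.trans h)⟩

theorem isModel_of_elementaryEmbedding (hM : K.IsModel M) (g : M ↪ₑ[L] N) : K.IsModel N :=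
  K.elementarilyEquivalent hM g.elementarilyEquivalent

theorem isModel_of_elementaryEmbedding' (hN : K.IsModel N) (g : M ↪ₑ[L] N) : K.IsModel M :=
  K.elementarilyEquivalent hN g.elementarilyEquivalent.symm

theorem isMorphism_of_elementaryEmbedding (hM : K.IsModel M) (g : M ↪ₑ[L] N) :
    K.IsMorphism (ofInjective g.toEmbedding.toEmbedding) :=
  K.elementary hM (K.isModel_of_elementaryEmbedding hM g) (isElementaryMap_ofInjective g)

theorem isMorphism_of_equiv (hM : K.IsModel M) (g : M ≃[L] N) :
    K.IsMorphism (ofInjective g.toEmbedding.toEmbedding) :=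
  K.isMorphism_of_elementaryEmbedding hM g.toElementaryEmbedding

theorem card_le_aleph0 [Countable L.Symbols] : L.card ≤ ℵ₀ :=
  Cardinal.mk_le_aleph0_iff.2 ‹_›

/-- A finite morphism into an `ℵ₀`-rich model extends to any further element. -/
theorem exists_extend_finite [Countable L.Symbols] {κ : Cardinal.{u}} (hκ : ℵ₀ ≤ κ)
    (hN : K.IsCardinalRich κ N) {f : M ≃. N} (hf : K.IsMorphism f) (hfin : (dom f).Finite)
    (a : M) : ∃ g : M ≃. N, K.IsMorphism g ∧ (dom g).Finite ∧ f ≤ g ∧ ∃ b, b ∈ g a := by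
  have hM := K.isModel_dom hf
  have := K.infinite hM
  have hfin' : (insert a (dom f)).Finite := hfin.insert a
  -- Richness only concerns domains of size at most `κ`, so `M` is replaced by a countable
  -- elementary submodel; a finite map is then small enough.
  obtain ⟨S, hS, hSc⟩ := L.exists_elementarySubstructure_card_eq (M := M) (insert a (dom f))
    (ℵ₀ : Cardinal.{u}) le_rfl
    (by simpa using hfin'.countable.le_aleph0) (by simpa using card_le_aleph0) (by simp)
  have hSc : #S = ℵ₀ := by simpa using hSc
  set i := ofInjective S.subtype.toEmbedding.toEmbedding with hi
  have hiS : K.IsMorphism i := K.isMorphism_of_elementaryEmbedding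
    (K.isModel_of_elementaryEmbedding' hM S.subtype) S.subtype
  have himem : ∀ (x : S) (y : M), y ∈ i x ↔ (x : M) = y := fun x y => mem_ofInjective _ _ _
  obtain ⟨h, hh, hht, hfh⟩ := hN.2 S (i.trans f) (K.comp hiS hf) (by
    rw [hSc, Cardinal.lt_aleph0_iff_set_finite]
    refine Set.Finite.of_finite_image (f := Subtype.val) (hfin.subset ?_)
      Subtype.val_injective.injOn
    rintro _ ⟨x, ⟨b, hb⟩, rfl⟩
    obtain ⟨y, hy, hb⟩ := (PEquiv.mem_trans _ _ _ _).1 hb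
    rw [himem] at hy
    exact ⟨b, hy ▸ hb⟩) (hSc.trans_le hκ)
  have hext : ∀ (x : M) (hx : x ∈ S) b, b ∈ h ⟨x, hx⟩ → b ∈ i.symm.trans h x := fun x hx b hb =>
    (PEquiv.mem_trans _ _ _ _).2 ⟨⟨x, hx⟩, i.mem_iff_mem.2 ((himem _ _).2 rfl), hb⟩
  refine ⟨restr (i.symm.trans h) (insert a (dom f)),
    K.restrict (K.comp (K.inverse hiS) hh) (restr_le _ _), hfin'.subset (dom_restr_subset _ _),
    fun x b hb => mem_restr.2 ⟨Or.inr ⟨b, hb⟩, hext x (hS (Or.inr ⟨b, hb⟩)) b (hfh _ _ ?_)⟩, ?_⟩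
  · exact (PEquiv.mem_trans _ _ _ _).2 ⟨x, (himem _ _).2 rfl, hb⟩
  · obtain ⟨b, hb⟩ := hht ⟨a, hS (Or.inl rfl)⟩
    exact ⟨b, mem_restr.2 ⟨Or.inl rfl, hext _ _ _ hb⟩⟩

/-- The Ehrenfeucht–Fraïssé argument: atomic formulas are preserved since morphisms are partial
embeddings, and at a quantifier the finite morphism is extended, using richness of `N` in one
direction and richness of `M`, through the inverse map, in the other. -/
theorem realize_iff_of_finite [Countable L.Symbols] {κ : Cardinal.{u}} (hκ : ℵ₀ ≤ κ)
    (hM : K.IsCardinalRich κ M) (hN : K.IsCardinalRich κ N) {α : Type*} [Finite α] {n : ℕ}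
    (φ : L.BoundedFormula α n) {f : M ≃. N} (hf : K.IsMorphism f) (hfin : (dom f).Finite)
    {v : α → M} {v' : α → N} {x : Fin n → M} {x' : Fin n → N} (hv : ∀ i, v' i ∈ f (v i))
    (hx : ∀ i, x' i ∈ f (x i)) : φ.Realize v x ↔ φ.Realize v' x' := by
  have hsum : ∀ {n : ℕ} {x : Fin n → M} {x' : Fin n → N} {f : M ≃. N}, (∀ i, v' i ∈ f (v i)) →
      (∀ i, x' i ∈ f (x i)) → ∀ j, (Sum.elim v' x' j) ∈ f (Sum.elim v x j) := by
    rintro n x x' f hv hx (j | j)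
    exacts [hv j, hx j]
  induction φ generalizing f with
  | falsum => exact Iff.rfl
  | equal t₁ t₂ =>
    have := (K.isPartialEmbedding hf).realize_iff (φ := t₁.equal t₂)
      (Language.BoundedFormula.IsAtomic.equal _ _).isQF (hsum hv hx)
    simpa [Language.BoundedFormula.Realize] using this
  | rel R ts =>
    have := (K.isPartialEmbedding hf).realize_iff (φ := R.formula ts)
      (Language.BoundedFormula.IsAtomic.rel _ _).isQF (hsum hv hx)
    simpa [Language.BoundedFormula.Realize, Language.Formula.realize_rel] using this
  | imp φ ψ ih₁ ih₂ =>
    simp only [Language.BoundedFormula.realize_imp, ih₁ hf hfin hv hx, ih₂ hf hfin hv hx]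
  | all φ ih =>
    simp only [Language.BoundedFormula.realize_all]
    have key : ∀ {g : M ≃. N}, f ≤ g → K.IsMorphism g → (dom g).Finite → ∀ a b, b ∈ g a →
        (φ.Realize v (Fin.snoc x a) ↔ φ.Realize v' (Fin.snoc x' b)) := by
      intro g hfg hg hgf a b hab
      refine ih hg hgf (fun i => hfg _ _ (hv i)) fun i => ?_
      refine Fin.lastCases ?_ (fun j => ?_) i
      · simpa using hab
      · simpa using hfg _ _ (hx j)
    constructor
    · intro h b
      obtain ⟨g, hg, hgf, hfg, a, hba⟩ := K.exists_extend_finite hκ hM (K.inverse hf) (by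
        rw [← Cardinal.lt_aleph0_iff_set_finite, mk_dom_symm,
          Cardinal.lt_aleph0_iff_set_finite]; exact hfin) b
      refine (key (g := g.symm) (fun x y hy => g.mem_iff_mem.2 (hfg _ _ (f.mem_iff_mem.2 hy)))
        (K.inverse hg) ?_ a b (g.mem_iff_mem.2 hba)).1 (h a)
      rwa [← Cardinal.lt_aleph0_iff_set_finite, mk_dom_symm,
          Cardinal.lt_aleph0_iff_set_finite]
    · intro h a
      obtain ⟨g, hg, hgf, hfg, b, hab⟩ := K.exists_extend_finite hκ hN hf hfin a
      exact (key hfg hg hgf a b hab).2 (h b)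

/-- Morphisms between rich models are elementary. -/
theorem isElementaryMap_of_rich [Countable L.Symbols] {κ μ : Cardinal.{u}} (hκ : ℵ₀ ≤ κ)
    (hμ : ℵ₀ ≤ μ) (hM : K.IsCardinalRich κ M) (hN : K.IsCardinalRich μ N) {f : M ≃. N}
    (hf : K.IsMorphism f) : IsElementaryMap L f := by
  intro n φ a b hab
  exact K.realize_iff_of_finite le_rfl (hM.mono hκ) (hN.mono hμ) φ
    (K.restrict hf (restr_le f (Set.range a)))
    ((Set.finite_range a).subset (dom_restr_subset _ _))
    (fun i => mem_restr.2 ⟨⟨i, rfl⟩, hab i⟩) (fun i => i.elim0)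

end InductiveAmalgamationClass

/-! ### Transfinite chains and cardinal bounds -/

/-- Transfinite iteration of inflationary maps in a preorder with enough upper bounds. -/
theorem exists_chain {P ι : Type*} [Preorder P] [LinearOrder ι] [WellFoundedLT ι] (p : P)
    (ub : ∀ (i : ι) (c : Set.Iio i → P), Monotone c → (∀ j, p ≤ c j) →
      ∃ q, p ≤ q ∧ ∀ j, c j ≤ q)
    (s : ι → P → P) (hs : ∀ i q, q ≤ s i q) :
    ∃ c : ι → P, (∀ i, p ≤ c i) ∧ ∀ i j, i < j → s i (c i) ≤ c j := by
  classical
  -- The fallback value `p` serves only to make the recursion total; `main` shows that an upper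
  -- bound always exists.
  let c : ι → P := WellFoundedLT.fix fun i rec =>
    if h : ∃ q, p ≤ q ∧ ∀ j (hj : j < i), s j (rec j hj) ≤ q then h.choose else p
  have hc : ∀ i, c i = if h : ∃ q, p ≤ q ∧ ∀ j, j < i → s j (c j) ≤ q then h.choose else p :=
    fun i => WellFoundedLT.fix_eq _ i
  have main : ∀ i, p ≤ c i ∧ ∀ j < i, s j (c j) ≤ c i := by
    intro i
    induction i using WellFoundedLT.induction with
    | ind i ih =>
      have h : ∃ q, p ≤ q ∧ ∀ j, j < i → s j (c j) ≤ q := by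
        obtain ⟨q, hq, hj⟩ := ub i (fun j => s j (c j)) (fun j k hjk => by
          rcases hjk.eq_or_lt with rfl | hjk
          · exact le_rfl
          · exact ((ih k k.2).2 j hjk).trans (hs _ _)) (fun j => (ih j j.2).1.trans (hs _ _))
        exact ⟨q, hq, fun j hji => hj ⟨j, hji⟩⟩
      rw [hc, dif_pos h]
      exact h.choose_spec
  exact ⟨c, fun i => (main i).1, fun i j hij => (main j).2 i hij⟩

section Cardinals

theorem power_lt_of_isStrongLimit {θ a b : Cardinal.{u}} (hθ : θ.IsStrongLimit) (ha : a < θ)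
    (hb : b < θ) : a ^ b < θ := by
  calc a ^ b ≤ (2 ^ a) ^ b := Cardinal.power_le_power_right (Cardinal.cantor a).le
    _ = 2 ^ (a * b) := by rw [Cardinal.power_mul]
    _ < θ := hθ.isStrongPrelimit (Cardinal.mul_lt_of_lt hθ.aleph0_le ha hb)

/-- Needed to list all extension problems over a small model in fewer than `θ` steps. Countably many
finitary symbols give fewer than `θ` pairs of a symbol and an argument tuple, and a structure is a
function and a subset on such pairs. -/
theorem mk_structure_lt {L : FirstOrder.Language.{0, 0}} [Countable L.Symbols]
    {θ : Cardinal.{u}} (hθ : θ.IsStrongLimit) (hθ' : ℵ₀ < θ) (T : Type u) (hT : #T < θ) :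
    #(L.Structure T) < θ := by
  have hlist : #(List T) < θ := (Cardinal.mk_list_le_max T).trans_lt (max_lt hθ' hT)
  have hcount : ∀ (F : ℕ → Type) [Countable (Σ n, F n)], #(Σ n, F n × (Fin n → T)) < θ := by
    intro F _
    have hinj : Function.Injective
        (fun x : Σ n, F n × (Fin n → T) =>
          ((ULift.up ⟨x.1, x.2.1⟩, List.ofFn x.2.2) : ULift.{u} (Σ n, F n) × List T)) := by
      rintro ⟨n, a, x⟩ ⟨m, b, y⟩ h
      simp only [Prod.mk.injEq, ULift.up.injEq, Sigma.mk.injEq] at h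
      obtain ⟨⟨rfl, h₁⟩, h₂⟩ := h
      rw [eq_of_heq h₁, List.ofFn_injective h₂]
    refine (Cardinal.mk_le_of_injective hinj).trans_lt ?_
    rw [Cardinal.mk_prod, Cardinal.lift_id, Cardinal.lift_id]
    exact Cardinal.mul_lt_of_lt hθ.aleph0_le (Cardinal.mk_le_aleph0.trans_lt hθ') hlist
  have : Countable (Σ n, L.Functions n) :=
    Function.Injective.countable (β := L.Symbols) Sum.inl_injective
  have : Countable (Σ n, L.Relations n) :=
    Function.Injective.countable (β := L.Symbols) Sum.inr_injective
  have hinj : Function.Injective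
      (fun S : L.Structure T =>
        ((fun x => S.funMap x.2.1 x.2.2, {x | S.RelMap x.2.1 x.2.2}) :
          ((Σ n, L.Functions n × (Fin n → T)) → T) ×
            Set (Σ n, L.Relations n × (Fin n → T)))) := by
    rintro S S' h
    simp only [Prod.mk.injEq] at h
    refine Language.Structure.ext ?_ ?_
    · funext n F x
      exact congrFun h.1 ⟨n, F, x⟩
    · funext n R x
      exact congrArg (fun s => (⟨n, R, x⟩ : Σ n, L.Relations n × (Fin n → T)) ∈ s) h.2
  refine (Cardinal.mk_le_of_injective hinj).trans_lt ?_
  rw [Cardinal.mk_prod, Cardinal.lift_id, Cardinal.lift_id]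
  refine Cardinal.mul_lt_of_lt hθ.aleph0_le ?_ ?_
  · rw [← Cardinal.power_def]
    exact power_lt_of_isStrongLimit hθ hT (hcount _)
  · rw [Cardinal.mk_set]
    exact hθ.isStrongPrelimit (hcount _)

theorem mk_pequiv_lt {θ : Cardinal.{u}} (hθ : θ.IsStrongLimit) {M N : Type u}
    (hM : #M < θ) (hN : #N < θ) : #(M ≃. N) < θ := by
  have hinj : Function.Injective (fun f : M ≃. N => (f : M → Option N)) :=
    DFunLike.coe_injective
  refine (Cardinal.mk_le_of_injective hinj).trans_lt ?_
  rw [← Cardinal.power_def]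
  refine power_lt_of_isStrongLimit hθ ?_ hM
  rw [Cardinal.mk_option]
  exact Cardinal.add_lt_of_lt hθ.aleph0_le hN (Cardinal.one_lt_aleph0.trans_le hθ.aleph0_le)

theorem exists_forall_lt_of_isRegular {θ : Cardinal.{u}} (hθ : θ.IsRegular) {A : Type u}
    (hA : #A < θ) (t : A → θ.ord.ToType) : ∃ i, ∀ a, t a < i := by
  by_contra! h
  have hcof : IsCofinal (Set.range t) := fun i => by
    obtain ⟨a, ha⟩ := h i
    exact ⟨t a, ⟨a, rfl⟩, ha⟩
  have := (Order.cof_le hcof).trans Cardinal.mk_range_le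
  rw [Ordinal.cof_toType, hθ.cof_ord] at this
  exact this.not_gt hA

theorem mk_Iio_lt {θ : Cardinal.{u}} (i : θ.ord.ToType) : #(Set.Iio i) < θ :=
  (Cardinal.mk_Iio_lt i (by simp)).trans_eq (by simp)

end Cardinals

/-! ### Strong inclusions inside an ambient set and unions of chains -/

open Classical in
/-- The identity on the intersection of two sets, as a map from one to the other. -/
noncomputable def incl {X : Type u} (A B : Set X) : A ≃. B where
  toFun a := if h : (a : X) ∈ B then some ⟨a, h⟩ else none
  invFun b := if h : (b : X) ∈ A then some ⟨b, h⟩ else none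
  inv := by
    rintro ⟨a, ha⟩ ⟨b, hb⟩
    simp only [Option.dite_none_right_eq_some, Option.some.injEq, Subtype.mk.injEq]
    constructor
    · rintro ⟨_, rfl⟩; exact ⟨hb, rfl⟩
    · rintro ⟨_, rfl⟩; exact ⟨ha, rfl⟩

theorem mem_incl {X : Type u} {A B : Set X} {a : A} {b : B} :
    b ∈ incl A B a ↔ (a : X) = b := by
  obtain ⟨b, hb⟩ := b
  simp only [incl, Option.mem_def, PEquiv.coe_mk, Option.dite_none_right_eq_some,
    Option.some.injEq, Subtype.mk.injEq]
  exact ⟨fun h => h.2, fun h => ⟨h ▸ hb, h⟩⟩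

theorem incl_eq_ofInjective {X : Type u} {A B : Set X} (h : A ⊆ B) :
    incl A B = ofInjective (Set.embeddingOfSubset A B h) := by
  refine pequiv_ext fun a b => ?_
  rw [mem_incl, mem_ofInjective, Subtype.ext_iff]
  rfl

/-- The hypothesis `A ⊆ B` ensures that no point of `A ∩ C` is lost on the way through `B`. -/
theorem incl_trans {X : Type u} {A B C : Set X} (h : A ⊆ B) :
    (incl A B).trans (incl B C) = incl A C := by
  refine pequiv_ext fun a c => ?_
  rw [PEquiv.mem_trans, mem_incl]
  exact ⟨fun ⟨b, hb, hc⟩ => (mem_incl.1 hb).trans (mem_incl.1 hc),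
    fun hc => ⟨⟨a, h a.2⟩, mem_incl.2 rfl, mem_incl.2 hc⟩⟩

theorem incl_symm {X : Type u} (A B : Set X) : (incl A B).symm = incl B A := by
  refine pequiv_ext fun a c => ?_
  rw [PEquiv.mem_iff_mem, mem_incl, mem_incl, eq_comm]

theorem incl_self {X : Type u} (A : Set X) : incl A A = PEquiv.refl A := by
  refine pequiv_ext fun a c => ?_
  rw [mem_incl, PEquiv.refl_apply, Option.mem_some_iff, Subtype.ext_iff]

namespace InductiveAmalgamationClass

variable {L : FirstOrder.Language.{0, 0}} (K : InductiveAmalgamationClass.{u} L)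

/-- The chain axiom for chains of strong embeddings. -/
theorem chain_embeddings {ι : Type u} [LinearOrder ι] [WellFoundedLT ι] [Nonempty ι]
    {M : Type u} [L.Structure M] (N : ι → Type u) [∀ i, L.Structure (N i)]
    (e : ∀ i, N i ↪[L] M) (hmono : ∀ i j, i < j → ∀ x, ∃ y, e j y = e i x)
    (hmodel : ∀ i, K.IsModel (N i))
    (hmor : ∀ i j, i < j → K.IsMorphism
      ((ofInjective (e i).toEmbedding).trans (ofInjective (e j).toEmbedding).symm))
    (hcov : ∀ x : M, ∃ i y, e i y = x) :
    ∀ i, K.IsMorphism (ofInjective (e i).toEmbedding) := by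
  have hS : Monotone fun i => (e i).toHom.range := by
    intro i j hij
    rcases hij.eq_or_lt with rfl | hij
    · exact le_rfl
    · rintro _ ⟨x, rfl⟩
      obtain ⟨y, hy⟩ := hmono i j hij x
      exact ⟨y, hy⟩
  have hE : ∀ i, K.IsMorphism (ofInjective (e i).equivRange.toEmbedding.toEmbedding) :=
    fun i => K.isMorphism_of_equiv (hmodel i) _
  have hE' : ∀ i x y, y ∈ ofInjective (e i).equivRange.toEmbedding.toEmbedding x ↔
      e i x = (y : M) := fun i x y => by
    rw [mem_ofInjective, Subtype.ext_iff]; rfl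
  have he : ∀ i x y, y ∈ ofInjective (e i).toEmbedding x ↔ e i x = y :=
    fun i x y => mem_ofInjective _ _ _
  obtain ⟨-, h⟩ := K.chain (fun i => (e i).toHom.range) hS (fun i => K.isModel_cod (hE i))
    (fun i j hij => by
      -- The ranges are isomorphic to the `N i`, and isomorphisms of models are morphisms, so strong
      -- inclusion is transported to the ranges.
      refine K.restrict (K.comp (K.inverse (hE i)) (K.comp (hmor i j hij) (hE j))) ?_
      rintro ⟨_, x, rfl⟩ b hb
      rw [mem_ofInjective] at hb
      obtain ⟨y, hy⟩ := hmono i j hij x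
      refine (PEquiv.mem_trans _ _ _ _).2 ⟨x, (PEquiv.mem_iff_mem _).2 ((hE' _ _ _).2 rfl),
        (PEquiv.mem_trans _ _ _ _).2 ⟨y, (PEquiv.mem_trans _ _ _ _).2
          ⟨e i x, (he _ _ _).2 rfl, (PEquiv.mem_iff_mem _).2 ((he _ _ _).2 hy)⟩,
          (hE' _ _ _).2 (hy.trans ?_)⟩⟩
      rw [← hb]; rfl)
    (fun x => by
      obtain ⟨i, y, rfl⟩ := hcov x
      exact ⟨i, y, rfl⟩)
  intro i
  refine K.restrict (K.comp (hE i) (h i)) fun x y hy => (PEquiv.mem_trans _ _ _ _).2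
    ⟨(e i).equivRange x, (hE' _ _ _).2 rfl, ?_⟩
  rw [mem_ofInjective] at hy ⊢
  exact hy

/-- The chain axiom presupposes a structure on the union. Symbols are interpreted in any stage
containing the given finite tuple; the choice is immaterial because strong inclusions are total
partial embeddings, hence embeddings. -/
theorem exists_structure_iUnion {X ι : Type u} [LinearOrder ι] [WellFoundedLT ι] [Nonempty ι]
    (A : ι → Set X) [∀ i, L.Structure (A i)] (hA : Monotone A)
    (hmodel : ∀ i, K.IsModel (A i))
    (hmor : ∀ i j, i < j → K.IsMorphism (incl (A i) (A j))) :
    ∃ _ : L.Structure (⋃ i, A i : Set X), ∀ i, K.IsMorphism (incl (A i) (⋃ i, A i)) := by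
  have hmor' : ∀ i j (hij : i ≤ j),
      IsPartialEmbedding L (ofInjective (Set.embeddingOfSubset _ _ (hA hij))) := by
    intro i j hij
    rw [← incl_eq_ofInjective]
    rcases hij.eq_or_lt with rfl | hij
    · rw [incl_self]
      exact K.isPartialEmbedding (K.id (hmodel i))
    · exact K.isPartialEmbedding (hmor i j hij)
  have hfun : ∀ i j, i ≤ j → ∀ {n} (F : L.Functions n) (x : Fin n → A i) (y : Fin n → A j),
      (∀ k, (x k : X) = y k) →
      ((Language.Structure.funMap F x : A i) : X) = (Language.Structure.funMap F y : A j) := by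
    intro i j hij n F x y hxy
    have := (hmor' i j hij).toEmbedding.map_fun F x
    refine (congrArg Subtype.val this).trans ?_
    congr 2
    funext k
    exact Subtype.ext (hxy k)
  have hfun' : ∀ i j {n} (F : L.Functions n) (x : Fin n → A i) (y : Fin n → A j),
      (∀ k, (x k : X) = y k) →
      ((Language.Structure.funMap F x : A i) : X) = (Language.Structure.funMap F y : A j) := by
    intro i j n F x y hxy
    rcases le_total i j with h | h
    · exact hfun i j h F x y hxy
    · exact (hfun j i h F y x fun k => (hxy k).symm).symm
  have hrel : ∀ i j, i ≤ j → ∀ {n} (R : L.Relations n) (x : Fin n → A i) (y : Fin n → A j),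
      (∀ k, (x k : X) = y k) →
      (Language.Structure.RelMap R x ↔ Language.Structure.RelMap R y) := by
    intro i j hij n R x y hxy
    have := (hmor' i j hij).toEmbedding.map_rel R x
    rw [← this]
    congr! 1
    funext k
    exact Subtype.ext (hxy k)
  have hrel' : ∀ i j {n} (R : L.Relations n) (x : Fin n → A i) (y : Fin n → A j),
      (∀ k, (x k : X) = y k) →
      (Language.Structure.RelMap R x ↔ Language.Structure.RelMap R y) := by
    intro i j n R x y hxy
    rcases le_total i j with h | h
    · exact hrel i j h R x y hxy
    · exact (hrel j i h R y x fun k => (hxy k).symm).symm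
  have hbound : ∀ {n} (x : Fin n → (⋃ i, A i : Set X)), ∃ i, ∀ k, (x k : X) ∈ A i := by
    intro n x
    choose t ht using fun k => Set.mem_iUnion.1 (x k).2
    obtain ⟨i, hi⟩ := Finite.exists_le t
    exact ⟨i, fun k => hA (hi k) (ht k)⟩
  choose b hb using @hbound
  let str : L.Structure (⋃ i, A i : Set X) :=
    { funMap := fun F x => ⟨(Language.Structure.funMap F fun k => (⟨x k, hb x k⟩ : A (b x)) : _),
        Set.mem_iUnion.2 ⟨b x, Subtype.coe_prop _⟩⟩
      RelMap := fun R x => Language.Structure.RelMap R fun k => (⟨x k, hb x k⟩ : A (b x)) }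
  refine ⟨str, ?_⟩
  let e : ∀ i, A i ↪[L] (⋃ i, A i : Set X) := fun i =>
    { Set.embeddingOfSubset _ _ (Set.subset_iUnion A i) with
      map_fun' := fun F x => Subtype.ext (hfun' _ _ F _ _ fun k => rfl)
      map_rel' := fun R x => hrel' _ _ R _ _ fun k => rfl }
  have he : ∀ i, ofInjective (e i).toEmbedding = incl (A i) (⋃ i, A i) := fun i =>
    (incl_eq_ofInjective (Set.subset_iUnion A i)).symm
  intro i
  rw [← he]
  refine K.chain_embeddings (fun i => A i) e (fun i j hij x => ⟨⟨x, hA hij.le x.2⟩, rfl⟩) hmodel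
    (fun i j hij => ?_) (fun x => ?_) i
  · rw [he, he, incl_symm, incl_trans (Set.subset_iUnion A i)]
    exact hmor i j hij
  · obtain ⟨i, hi⟩ := Set.mem_iUnion.1 x.2
    exact ⟨i, ⟨x, hi⟩, rfl⟩

/-! ### Absorbing models of inaccessible cardinality -/

/-- Models of cardinality less than `θ` whose underlying set is a subset of `X`. -/
structure SmallModel (X : Type u) (θ : Cardinal.{u}) where
  /-- The underlying set. -/
  carrier : Set X
  /-- The structure. -/
  str : L.Structure carrier
  isModel : K.IsModel carrier
  card_lt : #carrier < θ

namespace SmallModel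

variable {K} {X : Type u} {θ : Cardinal.{u}}

instance (p : K.SmallModel X θ) : L.Structure p.carrier := p.str

/-- The preorder of strong submodels. -/
instance : Preorder (K.SmallModel X θ) where
  le p q := p.carrier ⊆ q.carrier ∧ K.IsMorphism (incl p.carrier q.carrier)
  le_refl p := ⟨subset_rfl, incl_self p.carrier ▸ K.id p.isModel⟩
  le_trans p q r hpq hqr :=
    ⟨hpq.1.trans hqr.1, incl_trans (C := r.carrier) hpq.1 ▸ K.comp hpq.2 hqr.2⟩

theorem exists_upperBound (hθ : θ.IsRegular) {ι : Type u} [LinearOrder ι] [WellFoundedLT ι]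
    [Nonempty ι] (hι : #ι < θ) (c : ι → K.SmallModel X θ) (hc : Monotone c) :
    ∃ q, ∀ i, c i ≤ q := by
  obtain ⟨str, h⟩ := K.exists_structure_iUnion (fun i => (c i).carrier)
    (fun i j hij => (hc hij).1) (fun i => (c i).isModel) (fun i j hij => (hc hij.le).2)
  refine ⟨⟨⋃ i, (c i).carrier, str, K.isModel_cod (h (Classical.arbitrary ι)), ?_⟩, fun i =>
    ⟨Set.subset_iUnion (fun i => (c i).carrier) i, h i⟩⟩
  exact (Cardinal.card_iUnion_lt_iff_forall_of_isRegular hθ hι).2 fun i => (c i).card_lt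

/-- An abstract extension of `p` is copied into `X` with `p` kept fixed pointwise. There is room
because `p` is small, so its complement in `X` still has size `θ`. -/
theorem exists_equiv_of_extension (hX : #X = θ) (hθ : ℵ₀ ≤ θ) (p : K.SmallModel X θ)
    {N : Type u} [L.Structure N] (hN : #N < θ) (e : p.carrier ↪ N)
    (he : K.IsMorphism (ofInjective e)) :
    ∃ q, p ≤ q ∧ ∃ j : N ≃[L] q.carrier, ∀ a, (j (e a) : X) = a := by
  have : Infinite X := Cardinal.infinite_iff.2 (hX ▸ hθ)
  have hcompl : #(p.carrierᶜ : Set X) = θ :=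
    (Cardinal.mk_compl_of_infinite _ (p.card_lt.trans_eq hX.symm)).trans hX
  obtain ⟨t⟩ : Nonempty (N ↪ (p.carrierᶜ : Set X)) :=
    Cardinal.le_def _ _ |>.1 (hN.le.trans hcompl.ge)
  classical
  let g : N → X := fun x => if h : ∃ a, e a = x then h.choose else t x
  have hge : ∀ a, g (e a) = a := fun a => by
    have h : ∃ b, e b = e a := ⟨a, rfl⟩
    simp only [g, dif_pos h]
    exact congrArg _ (e.injective h.choose_spec)
  have hgt : ∀ x, (¬ ∃ a, e a = x) → g x = t x := fun x h => by simp only [g, dif_neg h]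
  have hg : Function.Injective g := by
    intro x y hxy
    by_cases hx : ∃ a, e a = x <;> by_cases hy : ∃ a, e a = y
    · obtain ⟨a, rfl⟩ := hx
      obtain ⟨b, rfl⟩ := hy
      rw [hge, hge] at hxy
      rw [Subtype.ext hxy]
    · obtain ⟨a, rfl⟩ := hx
      rw [hge, hgt y hy] at hxy
      exact absurd (hxy ▸ a.2) (t y).2
    · obtain ⟨a, rfl⟩ := hy
      rw [hge, hgt x hx] at hxy
      exact absurd (hxy ▸ a.2) (t x).2
    · rw [hgt x hx, hgt y hy] at hxy
      exact t.injective (Subtype.ext hxy)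
  let E : N ≃ Set.range g := Equiv.ofInjective g hg
  let str : L.Structure (Set.range g) := E.inducedStructure
  let j : N ≃[L] Set.range g := E.inducedStructureEquiv
  have hj : ∀ x, (j x : X) = g x := fun x => rfl
  have hjm := K.isMorphism_of_equiv (K.isModel_cod he) j
  refine ⟨⟨Set.range g, str, K.isModel_cod hjm, ?_⟩, ⟨?_, ?_⟩, j, fun a => (hj _).trans (hge a)⟩
  · exact Cardinal.mk_range_le.trans_lt hN
  · intro a ha
    exact ⟨e ⟨a, ha⟩, hge _⟩
  · refine K.restrict (K.comp he hjm) fun a b hab => ?_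
    rw [mem_incl] at hab
    exact (PEquiv.mem_trans _ _ _ _).2 ⟨e a, rfl, (mem_ofInjective _ _ _).2
      (Subtype.ext (((hj _).trans (hge a)).trans hab))⟩

/-- A morphism from a small model into `p` extends to a total one into some `q ≥ p`. -/
theorem exists_extend [Countable L.Symbols] (hX : #X = θ) (hθ : ℵ₀ < θ)
    (p : K.SmallModel X θ) {M : Type u} [L.Structure M] (hM : #M < θ) {f : M ≃. p.carrier}
    (hf : K.IsMorphism f) : ∃ q, p ≤ q ∧ ∃ h : M ≃. q.carrier, K.IsMorphism h ∧ IsTotal h ∧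
      f.trans (incl p.carrier q.carrier) ≤ h := by
  obtain ⟨N, _, e, h, he, het, hh, hht, hle⟩ := K.amalgamation hf
  obtain ⟨e, rfl⟩ := exists_eq_ofInjective het
  obtain ⟨h, rfl⟩ := exists_eq_ofInjective hht
  have hNm := K.isModel_cod he
  have := K.infinite hNm
  have hlt : #(Set.range e ∪ Set.range h : Set N) < θ :=
    (Cardinal.mk_union_le _ _).trans_lt (Cardinal.add_lt_of_lt hθ.le
      (Cardinal.mk_range_le.trans_lt p.card_lt) (Cardinal.mk_range_le.trans_lt hM))
  -- The amalgam may be too large; a small elementary submodel containing both images does as well,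
  -- by K0 and K1.
  obtain ⟨S, hS, hSc⟩ := L.exists_elementarySubstructure_card_eq (M := N)
    (Set.range e ∪ Set.range h) (max ℵ₀ #(Set.range e ∪ Set.range h : Set N)) (le_max_left _ _)
    (by simp) (by simpa using Or.inl card_le_aleph0)
    (by simpa using Cardinal.mk_set_le _)
  have hSc : #S < θ := by
    simp only [Cardinal.lift_id] at hSc
    rw [hSc]
    exact max_lt hθ hlt
  have hi : K.IsMorphism (ofInjective S.subtype.toEmbedding.toEmbedding) :=
    K.isMorphism_of_elementaryEmbedding (K.isModel_of_elementaryEmbedding' hNm S.subtype) _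
  have himem : ∀ (x : S) (y : N), y ∈ ofInjective S.subtype.toEmbedding.toEmbedding x ↔
    (x : N) = y := fun x y => mem_ofInjective _ _ _
  let e' : p.carrier ↪ S := e.codRestrict S fun a => hS (Or.inl ⟨a, rfl⟩)
  let h' : M ↪ S := h.codRestrict S fun a => hS (Or.inr ⟨a, rfl⟩)
  have he' : K.IsMorphism (ofInjective e') := by
    refine K.restrict (K.comp he (K.inverse hi)) fun a b hab => ?_
    rw [mem_ofInjective] at hab
    subst hab
    exact (PEquiv.mem_trans _ _ _ _).2 ⟨e a, rfl, (PEquiv.mem_iff_mem _).2 ((himem _ _).2 rfl)⟩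
  have hh' : K.IsMorphism (ofInjective h') := by
    refine K.restrict (K.comp hh (K.inverse hi)) fun a b hab => ?_
    rw [mem_ofInjective] at hab
    subst hab
    exact (PEquiv.mem_trans _ _ _ _).2 ⟨h a, rfl, (PEquiv.mem_iff_mem _).2 ((himem _ _).2 rfl)⟩
  obtain ⟨q, hpq, j, hj⟩ := p.exists_equiv_of_extension hX hθ.le hSc e' he'
  have hjm := K.isMorphism_of_equiv (K.isModel_cod he') j
  refine ⟨q, hpq, (ofInjective h').trans (ofInjective j.toEmbedding.toEmbedding),
    K.comp hh' hjm, fun a => ⟨j (h' a), rfl⟩, fun a b hab => ?_⟩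
  obtain ⟨c, hc, hcb⟩ := (PEquiv.mem_trans _ _ _ _).1 hab
  have hec : h a = e c := by
    have := hle a (e c) ((PEquiv.mem_trans _ _ _ _).2 ⟨c, hc, rfl⟩)
    rwa [mem_ofInjective] at this
  refine (PEquiv.mem_trans _ _ _ _).2 ⟨h' a, rfl, (mem_ofInjective _ _ _).2 ?_⟩
  have : h' a = e' c := Subtype.ext hec
  rw [this]
  exact Subtype.ext ((hj c).trans (mem_incl.1 hcb))

/-- One model above `p` extends all morphisms into `p` from models of cardinality at most
the successor of that of `p`. -/
theorem exists_extend_all [Countable L.Symbols] (hX : #X = θ) (hθ : θ.IsInaccessible)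
    (p : K.SmallModel X θ) : ∃ q, p ≤ q ∧ (∃ x ∈ q.carrier, x ∉ p.carrier) ∧
      ∀ (M : Type u) [L.Structure M] (f : M ≃. p.carrier), K.IsMorphism f →
        #M ≤ Order.succ #p.carrier → ∃ h : M ≃. q.carrier, K.IsMorphism h ∧ IsTotal h ∧
          f.trans (incl p.carrier q.carrier) ≤ h := by
  classical
  have hinf := K.infinite p.isModel
  have hμ : Order.succ #p.carrier < θ := hθ.isSuccLimit.succ_lt p.card_lt
  let T : Type u := (Order.succ #p.carrier).out
  have hT : #T = Order.succ #p.carrier := Cardinal.mk_out _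
  -- Every model of size at most the successor of `#p.carrier` embeds elementarily into a structure
  -- on `T`, so these fewer than `θ` problems account for all the others.
  let J : Type u := {x : L.Structure T × (T ≃. p.carrier) // @IsMorphism L K _ _ x.1 _ x.2}
  have hJ : #J < θ := by
    refine (Cardinal.mk_subtype_le _).trans_lt ?_
    rw [Cardinal.mk_prod, Cardinal.lift_id, Cardinal.lift_id]
    exact Cardinal.mul_lt_of_lt hθ.isStrongLimit.aleph0_le
      (mk_structure_lt hθ.isStrongLimit hθ.aleph0_lt T (hT ▸ hμ))
      (mk_pequiv_lt hθ.isStrongLimit (hT ▸ hμ) p.card_lt)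
  obtain ⟨_, _⟩ := exists_wellFoundedLT J
  -- the extension task attached to an index
  have htask : ∀ (i : J) (q : K.SmallModel X θ), ∃ r, q ≤ r ∧ (p ≤ q →
      letI := i.1.1
      ∃ h : T ≃. r.carrier, K.IsMorphism h ∧ IsTotal h ∧
        i.1.2.trans (incl p.carrier r.carrier) ≤ h) := by
    intro i q
    by_cases hpq : p ≤ q
    · let := i.1.1
      obtain ⟨r, hqr, h, hh, hht, hle⟩ := q.exists_extend hX hθ.aleph0_lt (hT ▸ hμ)
        (K.comp i.2 hpq.2)
      refine ⟨r, hqr, fun _ => ⟨h, hh, hht, ?_⟩⟩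
      rwa [PEquiv.trans_assoc, incl_trans hpq.1] at hle
    · exact ⟨q, le_rfl, fun h => absurd h hpq⟩
  choose s hs hs' using htask
  obtain ⟨c, hpc, hc⟩ := exists_chain p (fun i c hc hp => by
    rcases isEmpty_or_nonempty (Set.Iio i) with h | h
    · exact ⟨p, le_rfl, fun j => h.elim j⟩
    · obtain ⟨q, hq⟩ := exists_upperBound hθ.isRegular
        ((Cardinal.mk_set_le (Set.Iio i)).trans_lt hJ) c hc
      exact ⟨q, (hp (Classical.arbitrary _)).trans (hq _), hq⟩) s hs
  have hex : ∀ (M : Type u) [L.Structure M] (f : M ≃. p.carrier), K.IsMorphism f →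
      #M ≤ Order.succ #p.carrier → ∃ (i : J) (g : letI := i.1.1; M ↪ₑ[L] T),
        f ≤ (letI := i.1.1; (ofInjective g.toEmbedding.toEmbedding).trans i.1.2) := by
    intro M _ f hf hM
    have := K.infinite (K.isModel_dom hf)
    obtain ⟨N, ⟨g⟩, hN⟩ := L.exists_elementaryEmbedding_card_eq_of_ge M (Order.succ #p.carrier)
      ((Cardinal.lift_le_aleph0.2 card_le_aleph0).trans (Cardinal.aleph0_le_lift.2
        ((Cardinal.aleph0_le_mk p.carrier).trans (Order.le_succ _))))
      (by simpa using hM)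
    obtain ⟨E⟩ := Cardinal.eq.1 (hN.trans hT.symm)
    let str : L.Structure T := E.inducedStructure
    let j : N ≃[L] T := E.inducedStructureEquiv
    let g' : M ↪ₑ[L] T := j.toElementaryEmbedding.comp g
    refine ⟨⟨⟨str, (ofInjective g'.toEmbedding.toEmbedding).symm.trans f⟩,
      K.comp (K.inverse (K.isMorphism_of_elementaryEmbedding (K.isModel_dom hf) g')) hf⟩, g', ?_⟩
    intro a b hab
    exact (PEquiv.mem_trans _ _ _ _).2 ⟨g' a, rfl, (PEquiv.mem_trans _ _ _ _).2
      ⟨a, (PEquiv.mem_iff_mem _).2 rfl, hab⟩⟩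
  obtain ⟨i₀, -⟩ := hex p.carrier _ (K.id p.isModel) (Order.le_succ _)
  have : Nonempty J := ⟨i₀⟩
  obtain ⟨q, hq⟩ := exists_upperBound hθ.isRegular hJ (fun i => s i (c i)) (fun i j hij => by
    rcases hij.eq_or_lt with rfl | hij
    · exact le_rfl
    · exact (hc i j hij).trans (hs _ _))
  have hq' : ∀ i : J, letI := i.1.1
      ∃ h : T ≃. q.carrier, K.IsMorphism h ∧ IsTotal h ∧
        i.1.2.trans (incl p.carrier q.carrier) ≤ h := by
    intro i
    let := i.1.1
    obtain ⟨h, hh, hht, hle⟩ := hs' i (c i) (hpc i)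
    refine ⟨h.trans (incl (s i (c i)).carrier q.carrier), K.comp hh (hq i).2, fun a => ?_,
      fun a b hab => ?_⟩
    · obtain ⟨b, hb⟩ := hht a
      exact ⟨⟨b, (hq i).1 b.2⟩, (PEquiv.mem_trans _ _ _ _).2 ⟨b, hb, mem_incl.2 rfl⟩⟩
    · obtain ⟨d, hd, hdb⟩ := (PEquiv.mem_trans _ _ _ _).1 hab
      rw [mem_incl] at hdb
      have hdm : (d : X) ∈ (s i (c i)).carrier := ((hpc i).trans (hs _ _)).1 d.2
      exact (PEquiv.mem_trans _ _ _ _).2 ⟨⟨d, hdm⟩,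
        hle a _ ((PEquiv.mem_trans _ _ _ _).2 ⟨d, hd, mem_incl.2 rfl⟩), mem_incl.2 hdb⟩
  refine ⟨q, (hpc i₀).trans ((hs _ _).trans (hq i₀)), ?_, ?_⟩
  · by_contra! hsub
    obtain ⟨h, -, hht, -⟩ := hq' i₀
    obtain ⟨h, rfl⟩ := exists_eq_ofInjective hht
    have h₁ := Cardinal.mk_le_of_injective h.injective
    have h₂ := Cardinal.mk_le_mk_of_subset (s := q.carrier) (t := p.carrier) hsub
    rw [hT] at h₁
    exact (Order.lt_succ #p.carrier).not_ge (h₁.trans h₂)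
  · intro M _ f hf hM
    obtain ⟨i, g, hfg⟩ := hex M f hf hM
    let := i.1.1
    obtain ⟨h, hh, hht, hle⟩ := hq' i
    refine ⟨(ofInjective g.toEmbedding.toEmbedding).trans h,
      K.comp (K.isMorphism_of_elementaryEmbedding (K.isModel_dom hf) g) hh, fun a => ?_,
      fun a b hab => ?_⟩
    · obtain ⟨b, hb⟩ := hht (g a)
      exact ⟨b, (PEquiv.mem_trans _ _ _ _).2 ⟨g a, rfl, hb⟩⟩
    · obtain ⟨d, hd, hdb⟩ := (PEquiv.mem_trans _ _ _ _).1 hab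
      obtain ⟨x, hx, hxd⟩ := (PEquiv.mem_trans _ _ _ _).1 (hfg _ _ hd)
      exact (PEquiv.mem_trans _ _ _ _).2 ⟨x, hx, hle _ _
        ((PEquiv.mem_trans _ _ _ _).2 ⟨d, hxd, hdb⟩)⟩

end SmallModel

/-- For inaccessible `θ`, every model of cardinality less than `θ` has a strong extension of
cardinality `θ` into which all morphisms from models of cardinality less than `θ` extend. -/
theorem exists_extension_of_isInaccessible [Countable L.Symbols] {θ : Cardinal.{u}}
    (hθ : θ.IsInaccessible) {N : Type u} [L.Structure N] (hN : K.IsModel N) (hNθ : #N < θ) :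
    ∃ (V : Type u) (_ : L.Structure V) (e : N ↪ V), K.IsMorphism (ofInjective e) ∧ #V = θ ∧
      ∀ (M : Type u) [L.Structure M] (f : M ≃. V), K.IsMorphism f → #M < θ →
        ∃ h : M ≃. V, K.IsMorphism h ∧ IsTotal h ∧ f ≤ h := by
  have hreg := hθ.isRegular
  let X : Type u := θ.ord.ToType
  have hX : #X = θ := by simp [X]
  obtain ⟨t⟩ : Nonempty (N ↪ X) := Cardinal.le_def _ _ |>.1 (hNθ.le.trans hX.ge)
  let E : N ≃ Set.range t := Equiv.ofInjective t t.injective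
  let str₀ : L.Structure (Set.range t) := E.inducedStructure
  let j : N ≃[L] Set.range t := E.inducedStructureEquiv
  have hj := K.isMorphism_of_equiv hN j
  let p : K.SmallModel X θ :=
    ⟨Set.range t, str₀, K.isModel_cod hj, Cardinal.mk_range_le.trans_lt hNθ⟩
  choose s hs hsx hsext using fun q : K.SmallModel X θ => q.exists_extend_all hX hθ
  obtain ⟨c, hpc, hc⟩ := exists_chain (ι := X) p (fun i c hc hp => by
    rcases isEmpty_or_nonempty (Set.Iio i) with h | h
    · exact ⟨p, le_rfl, fun j => h.elim j⟩
    · obtain ⟨q, hq⟩ := SmallModel.exists_upperBound hreg (mk_Iio_lt i) c hc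
      exact ⟨q, (hp (Classical.arbitrary _)).trans (hq _), hq⟩) (fun _ => s) (fun _ => hs)
  have hmono : Monotone c := fun i j hij => by
    rcases hij.eq_or_lt with rfl | hij
    · exact le_rfl
    · exact (hs _).trans (hc i j hij)
  have hbdd : ∀ {A : Type u}, #A < θ → ∀ r : A → X, ∃ i, ∀ a, r a < i :=
    fun hA r => exists_forall_lt_of_isRegular hreg hA r
  have hne : Nonempty X := Cardinal.mk_ne_zero_iff.1 (hX ▸ hθ.ne_zero)
  obtain ⟨str, hV⟩ := K.exists_structure_iUnion (fun i => (c i).carrier)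
    (fun i j hij => (hmono hij).1) (fun i => (c i).isModel) (fun i j hij => (hmono hij.le).2)
  have hsub : ∀ i, (c i).carrier ⊆ ⋃ i, (c i).carrier :=
    Set.subset_iUnion fun i => (c i).carrier
  -- Each stage contributes a new point, and these points are distinct. They show that the union has
  -- size `θ`, and that the stages eventually reach any given size below `θ`.
  choose x hxs hxc using hsx
  have hxlt : ∀ i k, i < k → x (c i) ∈ (c k).carrier := fun i k hik =>
    (hc i k hik).1 (hxs _)
  have hxinj : ∀ i k, x (c i) = x (c k) → i = k := by
    intro i k h
    rcases lt_trichotomy i k with hik | hik | hik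
    · exact absurd (h ▸ hxlt i k hik) (hxc _)
    · exact hik
    · exact absurd (h ▸ hxlt k i hik) (hxc _)
  have hnext : ∀ i, ∃ k, i < k := fun i => by
    obtain ⟨k, hk⟩ := hbdd (A := PUnit) (by simpa using hθ.nat_lt 1) (fun _ => i)
    exact ⟨k, hk ⟨⟩⟩
  let i₀ : X := Classical.arbitrary X
  have he : K.IsMorphism ((ofInjective j.toEmbedding.toEmbedding).trans
      ((incl p.carrier (c i₀).carrier).trans (incl (c i₀).carrier (⋃ i, (c i).carrier)))) :=
    K.comp hj (K.comp (hpc i₀).2 (hV i₀))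
  rw [incl_trans (hpc i₀).1] at he
  have het : IsTotal ((ofInjective j.toEmbedding.toEmbedding).trans
      (incl p.carrier (⋃ i, (c i).carrier))) := fun a =>
    ⟨⟨j a, hsub i₀ ((hpc i₀).1 (j a).2)⟩, (PEquiv.mem_trans _ _ _ _).2
      ⟨j a, rfl, mem_incl.2 rfl⟩⟩
  obtain ⟨e, hee⟩ := exists_eq_ofInjective het
  refine ⟨(⋃ i, (c i).carrier : Set X), str, e, hee ▸ he, ?_, ?_⟩
  · refine le_antisymm ((Cardinal.mk_set_le _).trans_eq hX) (hX.symm.trans_le ?_)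
    choose k hk using hnext
    exact Cardinal.mk_le_of_injective
      (f := fun i => (⟨x (c i), hsub (k i) (hxlt _ _ (hk i))⟩ : (⋃ i, (c i).carrier : Set X)))
      fun i k h => hxinj i k (congrArg Subtype.val h)
  · intro M _ f hf hM
    -- By regularity the whole image of `f` lies in one stage. A later stage `i` also has at least
    -- `#M` elements, so the next one solves the extension problem for `M`.
    have hdom : ∀ a : M, ∃ i, ∀ b ∈ f a, (b : X) ∈ (c i).carrier := by
      intro a
      by_cases h : ∃ b, b ∈ f a
      · obtain ⟨b, hb⟩ := h
        obtain ⟨i, hi⟩ := Set.mem_iUnion.1 b.2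
        exact ⟨i, fun b' hb' => Option.mem_unique hb hb' ▸ hi⟩
      · exact ⟨i₀, fun b hb => absurd ⟨b, hb⟩ h⟩
    choose r hr using hdom
    obtain ⟨i₁, hi₁⟩ := hbdd hM r
    obtain ⟨r'⟩ : Nonempty (M ↪ X) := Cardinal.le_def _ _ |>.1 (hM.le.trans hX.ge)
    obtain ⟨i₂, hi₂⟩ := hbdd hM r'
    obtain ⟨i, hi⟩ : ∃ i, i = max i₁ i₂ := ⟨_, rfl⟩
    have hMc : #M ≤ #(c i).carrier :=
      Cardinal.mk_le_of_injective (f := fun a => (⟨x (c (r' a)),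
        hxlt _ _ ((hi₂ a).trans_le (hi ▸ le_max_right _ _))⟩ : (c i).carrier))
        fun a b h => r'.injective (hxinj _ _ (congrArg Subtype.val h))
    obtain ⟨h, hh, hht, hle⟩ := hsext (c i) M
      (f.trans (incl (⋃ i, (c i).carrier) (c i).carrier))
      (K.comp hf (incl_symm (c i).carrier _ ▸ K.inverse (hV i))) (hMc.trans (Order.le_succ _))
    obtain ⟨k, hik⟩ := hnext i
    have hsk : K.IsMorphism (incl (s (c i)).carrier (⋃ i, (c i).carrier)) :=
      incl_trans (C := ⋃ i, (c i).carrier) (hc i k hik).1 ▸ K.comp (hc i k hik).2 (hV k)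
    refine ⟨h.trans (incl (s (c i)).carrier _), K.comp hh hsk, fun a => ?_, fun a b hab => ?_⟩
    · obtain ⟨b, hb⟩ := hht a
      exact ⟨⟨b, hsub k ((hc i k hik).1 b.2)⟩,
        (PEquiv.mem_trans _ _ _ _).2 ⟨b, hb, mem_incl.2 rfl⟩⟩
    · have hbc : (b : X) ∈ (c i).carrier :=
        (hmono ((hi₁ a).le.trans (hi ▸ le_max_left _ _))).1 (hr a b hab)
      refine (PEquiv.mem_trans _ _ _ _).2 ⟨⟨b, (hs (c i)).1 hbc⟩, hle _ _ ?_, mem_incl.2 rfl⟩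
      exact (PEquiv.mem_trans _ _ _ _).2 ⟨⟨b, hbc⟩,
        (PEquiv.mem_trans _ _ _ _).2 ⟨b, hab, mem_incl.2 rfl⟩, mem_incl.2 rfl⟩

end InductiveAmalgamationClass

/-! ### Finite character of morphisms and existence of rich models -/

open Classical in
/-- The map with a given graph. -/
noncomputable def ofGraph {M N : Type u} (G : Set (M × N))
    (hG : ∀ x ∈ G, ∀ y ∈ G, x.1 = y.1 ↔ x.2 = y.2) : M ≃. N where
  toFun a := if h : ∃ b, (a, b) ∈ G then some h.choose else none
  invFun b := if h : ∃ a, (a, b) ∈ G then some h.choose else none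
  inv a b := by
    simp only [Option.dite_none_right_eq_some, Option.some.injEq]
    constructor
    · rintro ⟨h, rfl⟩
      exact ⟨⟨_, h.choose_spec⟩, ((hG _ (Exists.choose_spec (p := fun c => (h.choose, c) ∈ G)
        ⟨b, h.choose_spec⟩) _ h.choose_spec).1 rfl)⟩
    · rintro ⟨h, rfl⟩
      exact ⟨⟨_, h.choose_spec⟩, ((hG _ (Exists.choose_spec (p := fun c => (c, h.choose) ∈ G)
        ⟨a, h.choose_spec⟩) _ h.choose_spec).2 rfl)⟩

theorem mem_ofGraph {M N : Type u} {G : Set (M × N)}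
    {hG : ∀ x ∈ G, ∀ y ∈ G, x.1 = y.1 ↔ x.2 = y.2} {a : M} {b : N} :
    b ∈ ofGraph G hG a ↔ (a, b) ∈ G := by
  simp only [ofGraph, Option.mem_def, PEquiv.coe_mk, Option.dite_none_right_eq_some,
    Option.some.injEq]
  constructor
  · rintro ⟨h, rfl⟩
    exact h.choose_spec
  · intro h
    have h' : ∃ c, (a, c) ∈ G := ⟨b, h⟩
    exact ⟨h', (hG _ h'.choose_spec _ h).1 rfl⟩

namespace InductiveAmalgamationClass

variable {L : FirstOrder.Language.{0, 0}} (K : InductiveAmalgamationClass.{u} L)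
variable {M N : Type u} [L.Structure M] [L.Structure N]

/-- Every model has an `ℵ₀`-rich strong extension. -/
def HasRichExtensions : Prop :=
  ∀ (N : Type u) [L.Structure N], K.IsModel N → ∃ (V : Type u) (_ : L.Structure V) (e : N ↪ V),
    K.IsMorphism (ofInjective e) ∧ K.IsCardinalRich ℵ₀ V

variable {K}

/-- Morphisms have finite character. -/
theorem HasRichExtensions.isMorphism_of_finite [Countable L.Symbols] (H : K.HasRichExtensions)
    {f : M ≃. N} (hf : ∀ s : Set M, s.Finite → K.IsMorphism (restr f s)) : K.IsMorphism f := by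
  have h₀ := hf ∅ Set.finite_empty
  obtain ⟨M', _, e, he, hM'⟩ := H M (K.isModel_dom h₀)
  obtain ⟨N', _, e', he', hN'⟩ := H N (K.isModel_cod h₀)
  -- A formula involves finitely many elements, on which `f` agrees with a finite restriction; that
  -- restriction is a morphism between `ℵ₀`-rich models, hence elementary.
  have key : IsElementaryMap L ((ofInjective e).symm.trans (f.trans (ofInjective e'))) := by
    intro n φ a b hab
    choose x hx hxb using fun i => (PEquiv.mem_trans _ _ _ _).1 (hab i)
    choose y hy hyb using fun i => (PEquiv.mem_trans _ _ _ _).1 (hxb i)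
    refine K.isElementaryMap_of_rich le_rfl le_rfl hM' hN' (K.comp (K.inverse he)
      (K.comp (hf (Set.range x) (Set.finite_range x)) he')) n φ a b fun i => ?_
    exact (PEquiv.mem_trans _ _ _ _).2 ⟨x i, hx i, (PEquiv.mem_trans _ _ _ _).2
      ⟨y i, mem_restr.2 ⟨⟨i, rfl⟩, hy i⟩, hyb i⟩⟩
  refine K.restrict (K.comp he (K.comp (K.elementary hM'.1 hN'.1 key) (K.inverse he')))
    fun a b hab => ?_
  exact (PEquiv.mem_trans _ _ _ _).2 ⟨e a, rfl, (PEquiv.mem_trans _ _ _ _).2 ⟨e' b,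
    (PEquiv.mem_trans _ _ _ _).2 ⟨a, (PEquiv.mem_iff_mem _).2 rfl,
      (PEquiv.mem_trans _ _ _ _).2 ⟨b, hab, rfl⟩⟩, (PEquiv.mem_iff_mem _).2 rfl⟩⟩

variable (K) in
/-- The pairs in `G` are matched by a morphism. -/
def Matched (G : Set (M × N)) : Prop :=
  ∃ g : M ≃. N, K.IsMorphism g ∧ ∀ x ∈ G, x.2 ∈ g x.1

theorem Matched.mono {G G' : Set (M × N)} (h : K.Matched G') (hG : G ⊆ G') : K.Matched G := by
  obtain ⟨g, hg, hg'⟩ := h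
  exact ⟨g, hg, fun x hx => hg' x (hG hx)⟩

/-- Two-element subsets already force `G` to be the graph of a partial injection; finite character
does the rest. -/
theorem HasRichExtensions.matched_of_finite [Countable L.Symbols] (H : K.HasRichExtensions)
    {G : Set (M × N)} (hG : ∀ F ⊆ G, F.Finite → K.Matched F) : K.Matched G := by
  have hfun : ∀ x ∈ G, ∀ y ∈ G, x.1 = y.1 ↔ x.2 = y.2 := by
    intro x hx y hy
    obtain ⟨g, -, hg⟩ := hG {x, y} (Set.insert_subset hx (by simpa using hy)) (by simp)
    have h₁ := hg x (by simp)
    have h₂ := hg y (by simp)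
    constructor
    · intro h
      rw [h] at h₁
      exact Option.mem_unique h₁ h₂
    · intro h
      rw [h] at h₁
      exact g.inj h₁ h₂
  refine ⟨ofGraph G hfun, H.isMorphism_of_finite fun s hs => ?_, fun x hx => mem_ofGraph.2 hx⟩
  obtain ⟨g, hg, hgG⟩ := hG {x ∈ G | x.1 ∈ s} (fun x hx => hx.1) (by
    refine Set.Finite.of_finite_image (f := Prod.fst) (hs.subset ?_) fun x hx y hy h =>
      Prod.ext h ((hfun x hx.1 y hy.1).1 h)
    rintro _ ⟨x, hx, rfl⟩
    exact hx.2)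
  refine K.restrict hg fun a b hab => ?_
  obtain ⟨ha, hb⟩ := mem_restr.1 hab
  exact hgG (a, b) ⟨mem_ofGraph.1 hb, ha⟩

/-- A finite part of the union lies in a single `G i`. This is the limit step when a map is extended
one point at a time. -/
theorem HasRichExtensions.matched_iUnion [Countable L.Symbols] (H : K.HasRichExtensions)
    {ι : Type*} [LinearOrder ι] [Nonempty ι] {G : ι → Set (M × N)} (hmono : Monotone G)
    (hG : ∀ i, K.Matched (G i)) : K.Matched (⋃ i, G i) := by
  refine H.matched_of_finite fun F hF hfin => ?_
  choose t ht using fun x : F => Set.mem_iUnion.1 (hF x.2)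
  have := hfin.to_subtype
  obtain ⟨i, hi⟩ := Finite.exists_le t
  exact (hG i).mono fun x hx => hmono (hi ⟨x, hx⟩) (ht ⟨x, hx⟩)

/-- `N` extends all morphisms from models of cardinality less than `θ`. -/
def Absorbs (K : InductiveAmalgamationClass.{u} L) (θ : Cardinal.{u}) (N : Type u)
    [L.Structure N] : Prop :=
  ∀ (M : Type u) [L.Structure M] (f : M ≃. N), K.IsMorphism f → #M < θ →
    ∃ h : M ≃. N, K.IsMorphism h ∧ IsTotal h ∧ f ≤ h

/-- `M` may be large, but an elementary submodel of size below `θ` contains `a` and the first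
coordinates of `G`; absorption applies to it. -/
theorem Absorbs.exists_matched_insert [Countable L.Symbols] {θ : Cardinal.{u}} (hθ : ℵ₀ < θ)
    (hN : K.Absorbs θ N) {G : Set (M × N)} (hG : K.Matched G) (hcard : #G < θ) (a : M) :
    ∃ b, K.Matched (insert (a, b) G) := by
  obtain ⟨g, hg, hgG⟩ := hG
  have hM := K.isModel_dom hg
  have := K.infinite hM
  let s : Set M := insert a (Prod.fst '' G)
  have hs : #s < θ := (Cardinal.mk_insert_le).trans_lt (Cardinal.add_lt_of_lt hθ.le
    (Cardinal.mk_image_le.trans_lt hcard) (Cardinal.one_lt_aleph0.trans hθ))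
  obtain ⟨S, hS, hSc⟩ := L.exists_elementarySubstructure_card_eq (M := M) s (max ℵ₀ #s)
    (le_max_left _ _) (by simp) (by simpa using Or.inl card_le_aleph0)
    (by simpa using Cardinal.mk_set_le _)
  have hSc : #S < θ := by
    simp only [Cardinal.lift_id] at hSc
    rw [hSc]
    exact max_lt hθ hs
  set i := ofInjective S.subtype.toEmbedding.toEmbedding with hi
  have hiS : K.IsMorphism i := K.isMorphism_of_elementaryEmbedding
    (K.isModel_of_elementaryEmbedding' hM S.subtype) S.subtype
  have himem : ∀ (x : S) (y : M), y ∈ i x ↔ (x : M) = y := fun x y => mem_ofInjective _ _ _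
  obtain ⟨h, hh, hht, hgh⟩ := hN S (i.trans g) (K.comp hiS hg) hSc
  obtain ⟨b, hb⟩ := hht ⟨a, hS (Or.inl rfl)⟩
  refine ⟨b, i.symm.trans h, K.comp (K.inverse hiS) hh, ?_⟩
  rintro x (rfl | hx)
  · exact (PEquiv.mem_trans _ _ _ _).2 ⟨_, i.mem_iff_mem.2 ((himem _ _).2 rfl), hb⟩
  · exact (PEquiv.mem_trans _ _ _ _).2 ⟨⟨x.1, hS (Or.inr ⟨x, hx, rfl⟩)⟩,
      i.mem_iff_mem.2 ((himem _ _).2 rfl), hgh _ _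
        ((PEquiv.mem_trans _ _ _ _).2 ⟨x.1, (himem _ _).2 rfl, hgG x hx⟩)⟩

theorem Absorbs.isCardinalRich_aleph0 {θ : Cardinal.{u}} (hθ : ℵ₀ < θ) (hmodel : K.IsModel N)
    (hN : K.Absorbs θ N) : K.IsCardinalRich ℵ₀ N :=
  ⟨hmodel, fun M _ f hf _ hM => hN M f hf (hM.trans_lt hθ)⟩

/-- Only `#M = θ` is not immediate. There `M` is enumerated in order type `θ`, so that at every
stage fewer than `θ` pairs have been matched and one more point can be added. -/
theorem HasRichExtensions.isCardinalRich_of_absorbs [Countable L.Symbols]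
    (H : K.HasRichExtensions) {θ : Cardinal.{u}} (hθ : ℵ₀ < θ) (hmodel : K.IsModel N)
    (hN : K.Absorbs θ N) : K.IsCardinalRich θ N := by
  classical
  refine ⟨hmodel, fun M _ f hf hfM hM => ?_⟩
  rcases hM.lt_or_eq with hM | hM
  · exact hN M f hf hM
  have := K.infinite hmodel
  let X : Type u := θ.ord.ToType
  obtain ⟨m⟩ : Nonempty (X ≃ M) := Cardinal.eq.1 (by simp [X, hM])
  let G₀ : Set (M × N) := {x | x.2 ∈ f x.1}
  have hG₀ : K.Matched G₀ := ⟨f, hf, fun x hx => hx⟩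
  have hG₀c : #G₀ < θ := by
    refine lt_of_le_of_lt ?_ (hfM.trans_eq hM)
    refine Cardinal.mk_le_of_injective (f := fun x : G₀ => (⟨x.1.1, x.1.2, x.2⟩ : dom f))
      fun x y h => ?_
    have h₁ : x.1.1 = y.1.1 := congrArg Subtype.val h
    exact Subtype.ext (Prod.ext h₁ (Option.mem_unique x.2 (h₁ ▸ y.2)))
  -- The arbitrary value is never taken: `hG` shows by induction that a suitable `b` always exists.
  let y : X → N := WellFoundedLT.fix fun i rec =>
    if h : ∃ b, K.Matched (insert (m i, b) (G₀ ∪ {x | ∃ j, ∃ hj : j < i, (m j, rec j hj) = x}))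
    then h.choose else Classical.arbitrary N
  have hy : ∀ i, y i =
      if h : ∃ b, K.Matched (insert (m i, b) (G₀ ∪ {x | ∃ j, ∃ _ : j < i, (m j, y j) = x}))
      then h.choose else Classical.arbitrary N := fun i => WellFoundedLT.fix_eq _ i
  -- With `j ≤ i` in place of `j < i`, stage `i` already contains the pair of `m i`, so the union of
  -- the stages is total.
  let G : X → Set (M × N) := fun i => G₀ ∪ {x | ∃ j, ∃ _ : j ≤ i, (m j, y j) = x}
  have hGmono : Monotone G := fun i k hik =>
    Set.union_subset_union_right _ fun x ⟨j, hj, hx⟩ => ⟨j, hj.trans hik, hx⟩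
  have hG : ∀ i, K.Matched (G i) := by
    intro i
    induction i using WellFoundedLT.induction with
    | ind i ih =>
      have hlt : K.Matched (G₀ ∪ {x | ∃ j, ∃ _ : j < i, (m j, y j) = x}) := by
        rcases isEmpty_or_nonempty (Set.Iio i) with h | h
        · refine hG₀.mono (Set.union_subset subset_rfl ?_)
          rintro _ ⟨j, hj, -⟩
          exact (h.false ⟨j, hj⟩).elim
        · refine (H.matched_iUnion (ι := Set.Iio i) (G := fun j => G j)
            (fun j k hjk => hGmono hjk) (fun j => ih j j.2)).mono (Set.union_subset ?_ ?_)
          · exact fun x hx => Set.mem_iUnion.2 ⟨Classical.arbitrary _, Or.inl hx⟩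
          · rintro _ ⟨j, hj, rfl⟩
            exact Set.mem_iUnion.2 ⟨⟨j, hj⟩, Or.inr ⟨j, le_rfl, rfl⟩⟩
      have hex := hN.exists_matched_insert hθ hlt (by
        refine (Cardinal.mk_union_le _ _).trans_lt (Cardinal.add_lt_of_lt hθ.le hG₀c ?_)
        refine lt_of_le_of_lt ?_ (mk_Iio_lt i)
        refine Cardinal.mk_le_of_surjective
          (f := fun j : Set.Iio i => ⟨(m j, y j), j, j.2, rfl⟩) ?_
        rintro ⟨_, j, hj, rfl⟩
        exact ⟨⟨j, hj⟩, rfl⟩) (m i)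
      have hyi := hy i
      rw [dif_pos hex] at hyi
      have hspec := hex.choose_spec
      rw [← hyi] at hspec
      refine hspec.mono ?_
      rintro x (hx | ⟨j, hj, rfl⟩)
      · exact Or.inr (Or.inl hx)
      · rcases hj.eq_or_lt with rfl | hj
        · exact Or.inl rfl
        · exact Or.inr (Or.inr ⟨j, hj, rfl⟩)
  have : Nonempty X := ⟨m.symm (Classical.choice (K.infinite (K.isModel_dom hf)).nonempty)⟩
  obtain ⟨h, hh, hhG⟩ := H.matched_iUnion hGmono hG
  refine ⟨h, hh, fun a => ⟨y (m.symm a), ?_⟩, fun a b hab => ?_⟩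
  · exact hhG (a, _) (Set.mem_iUnion.2 ⟨m.symm a, Or.inr ⟨m.symm a, le_rfl,
      Prod.ext (m.apply_symm_apply a) rfl⟩⟩)
  · exact hhG (a, b) (Set.mem_iUnion.2 ⟨Classical.arbitrary X, Or.inl hab⟩)

variable (K) in
theorem hasRichExtensions [Countable L.Symbols]
    (inaccessibles : ∀ μ : Cardinal.{u}, ∃ θ : Cardinal.{u}, μ < θ ∧ θ.IsInaccessible) :
    K.HasRichExtensions := by
  intro N _ hN
  obtain ⟨θ, hNθ, hθ⟩ := inaccessibles #N
  obtain ⟨V, _, e, he, -, hV⟩ := K.exists_extension_of_isInaccessible hθ hN hNθ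
  exact ⟨V, _, e, he, Absorbs.isCardinalRich_aleph0 hθ.aleph0_lt (K.isModel_cod he) hV⟩

variable (K) in
/-- Every model strongly embeds into arbitrarily large rich models. -/
theorem exists_rich_extension [Countable L.Symbols]
    (inaccessibles : ∀ μ : Cardinal.{u}, ∃ θ : Cardinal.{u}, μ < θ ∧ θ.IsInaccessible)
    (hN : K.IsModel N) (κ : Cardinal.{u}) :
    ∃ (V : Type u) (_ : L.Structure V) (e : N ↪ V), K.IsMorphism (ofInjective e) ∧
      K.IsRich V ∧ κ ≤ #V := by
  obtain ⟨θ, hNθ, hθ⟩ := inaccessibles (max #N κ)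
  obtain ⟨V, _, e, he, hVθ, hV⟩ :=
    K.exists_extension_of_isInaccessible hθ hN ((le_max_left _ _).trans_lt hNθ)
  refine ⟨V, _, e, he, ?_, ?_⟩
  · rw [IsRich, hVθ]
    exact (K.hasRichExtensions inaccessibles).isCardinalRich_of_absorbs hθ.aleph0_lt
      (K.isModel_cod he) hV
  · rw [hVθ]
    exact (le_max_right _ _).trans hNθ.le

variable (K) in
/-- Every rich model is an elementary submodel of arbitrarily large rich models. -/
theorem exists_rich_elementary_extension [Countable L.Symbols]
    (inaccessibles : ∀ μ : Cardinal.{u}, ∃ θ : Cardinal.{u}, μ < θ ∧ θ.IsInaccessible)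
    {μ : Cardinal.{u}} (hμ : ℵ₀ ≤ μ) (hN : K.IsCardinalRich μ N) (κ : Cardinal.{u}) :
    ∃ (V : Type u) (_ : L.Structure V) (e : N ↪ V), K.IsMorphism (ofInjective e) ∧
      IsElementaryMap L (ofInjective e) ∧ K.IsRich V ∧ κ ≤ #V := by
  obtain ⟨V, _, e, he, hV, hκ⟩ := K.exists_rich_extension inaccessibles hN.1 κ
  have := K.infinite hV.1
  exact ⟨V, _, e, he, K.isElementaryMap_of_rich hμ (Cardinal.aleph0_le_mk V) hN hV he, hV, hκ⟩

end InductiveAmalgamationClass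

/-! ### Compactness and realization of types -/

variable {L : FirstOrder.Language.{0, 0}}

/-- Compactness: a set of formulas finitely satisfiable in an infinite structure is realized in a
structure of any sufficiently large cardinality. -/
theorem exists_realize_of_finitelySatisfiable [Countable L.Symbols] {U : Type u} [L.Structure U]
    [Infinite U] {I : Type u} (q : Set (L.Formula I))
    (hq : ∀ r ⊆ q, r.Finite → ∃ v : I → U, ∀ φ ∈ r, φ.Realize v) {μ : Cardinal.{u}}
    (hμ : ℵ₀ ≤ μ) (hI : #I ≤ μ) :
    ∃ (M : Type u) (_ : L.Structure M) (v : I → M), #M = μ ∧ ∀ φ ∈ q, φ.Realize v := by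
  -- The variables in `I` become constants; the axioms of infinity let Löwenheim–Skolem produce a
  -- model of cardinality exactly `μ`.
  let T : L[[I]].Theory := (Language.Formula.equivSentence '' q) ∪ L[[I]].infiniteTheory
  have hT : T.IsSatisfiable := by
    rw [Language.Theory.isSatisfiable_iff_isFinitelySatisfiable]
    intro T₀ hT₀
    obtain ⟨v, hv⟩ := hq {φ ∈ q | Language.Formula.equivSentence φ ∈ T₀} (fun φ h => h.1)
      (Set.Finite.subset (T₀.finite_toSet.preimage
        Language.Formula.equivSentence.injective.injOn) fun φ h => h.2)
    let := Language.constantsOn.structure v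
    have hmod : U ⊨ (T₀ : L[[I]].Theory) := by
      refine ⟨fun φ hφ => ?_⟩
      rcases hT₀ hφ with ⟨ψ, hψ, rfl⟩ | h
      · exact (Language.Formula.realize_equivSentence U ψ).2 (hv ψ ⟨hψ, hφ⟩)
      · exact Language.Theory.realize_sentence_of_mem L[[I]].infiniteTheory h
    exact Language.Theory.Model.isSatisfiable U
  obtain ⟨N₀⟩ := hT
  have hN₀ : Infinite N₀ := by
    have : N₀ ⊨ L[[I]].infiniteTheory := N₀.is_model.mono Set.subset_union_right
    exact (Language.model_infiniteTheory_iff _).1 this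
  obtain ⟨N, hN⟩ := Language.Theory.exists_model_card_eq ⟨N₀, hN₀⟩ μ hμ (by
    rw [Language.card_withConstants]
    simp only [Cardinal.lift_id, Cardinal.lift_uzero]
    exact Cardinal.add_le_of_le hμ
      ((Cardinal.lift_le_aleph0.2 InductiveAmalgamationClass.card_le_aleph0).trans hμ) hI)
  let := (L.lhomWithConstants I).reduct N
  have : (L.lhomWithConstants I).IsExpansionOn N := Language.LHom.isExpansionOn_reduct _ _
  refine ⟨N, inferInstance, fun i => (L.con i : N), hN, fun φ hφ => ?_⟩
  exact (Language.Formula.realize_equivSentence N φ).1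
    (Language.Theory.realize_sentence_of_mem T (Or.inl ⟨φ, hφ, rfl⟩))

/-- Saturation is applied to the type of `a` over no parameters. A finite part is satisfiable in `U`
because the existential closure of its conjunction holds in `M`, hence in `U`; negations give the
converse implication. -/
theorem IsSaturated.exists_realize_iff {κ : Cardinal.{u}} (hκ : ℵ₀ ≤ κ) {U M : Type u}
    [L.Structure U] [L.Structure M] (hU : IsSaturated L κ U) (hMU : M ≅[L] U) {n : ℕ}
    (a : Fin n → M) :
    ∃ z : Fin n → U, ∀ φ : L.Formula (Fin n), φ.Realize a ↔ φ.Realize z := by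
  obtain ⟨z, hz⟩ := hU ∅ (by simpa using Cardinal.aleph0_pos.trans_le hκ) n
    ((L.lhomWithConstants (∅ : Set U)).onFormula '' {φ | φ.Realize a}) (by
      intro q hq hfin
      have := hfin.to_subtype
      choose ψ hψ hψq using fun x : q => hq x.2
      let χ : L.Formula (Fin n) := Language.Formula.iInf ψ
      have hχ : χ.Realize a := Language.Formula.realize_iInf.2 hψ
      let σ : L.Sentence := Language.Formula.iExs (Fin n) (χ.relabel (Sum.inr : _ → Empty ⊕ Fin n))
      have hσ : ∀ (S : Type u) [L.Structure S], S ⊨ σ ↔ ∃ v : Fin n → S, χ.Realize v := by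
        intro S _
        simp only [σ, Language.Sentence.Realize, Language.Formula.realize_iExs,
          Language.Formula.realize_relabel, Sum.elim_comp_inr]
      obtain ⟨v, hv⟩ := (hσ U).1 (((Language.elementarilyEquivalent_iff).1 hMU σ).1
        ((hσ M).2 ⟨a, hχ⟩))
      refine ⟨v, fun φ hφ => ?_⟩
      have h := Language.Formula.realize_iInf.1 hv ⟨φ, hφ⟩
      rwa [← Language.LHom.realize_onFormula (L.lhomWithConstants (∅ : Set U)), hψq] at h)
  have hz' : ∀ φ : L.Formula (Fin n), φ.Realize a → φ.Realize z := fun φ hφ => by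
    have := hz _ ⟨φ, hφ, rfl⟩
    rwa [Language.LHom.realize_onFormula] at this
  refine ⟨z, fun φ => ⟨hz' φ, fun h => ?_⟩⟩
  by_contra hn
  exact hz' φ.not hn h

/-- Two families that satisfy the same formulas are matched by an elementary map. -/
theorem exists_elementaryMap_of_family {M N : Type u} [L.Structure M] [L.Structure N]
    {I : Type*} (x : I → M) (y : I → N)
    (h : ∀ φ : L.Formula I, φ.Realize x ↔ φ.Realize y) :
    ∃ f : M ≃. N, IsElementaryMap L f ∧ (∀ i, y i ∈ f (x i)) ∧ dom f ⊆ Set.range x := by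
  have hG : ∀ p ∈ Set.range (fun i => (x i, y i)), ∀ p' ∈ Set.range (fun i => (x i, y i)),
      p.1 = p'.1 ↔ p.2 = p'.2 := by
    rintro _ ⟨i, rfl⟩ _ ⟨j, rfl⟩
    simpa [Language.Formula.realize_equal] using
      h ((Language.Term.var i).equal (Language.Term.var j))
  refine ⟨ofGraph _ hG, ?_, fun i => mem_ofGraph.2 ⟨i, rfl⟩, ?_⟩
  · intro n φ a b hab
    choose t ht using fun i => mem_ofGraph.1 (hab i)
    have ha : a = x ∘ t := funext fun i => (congrArg Prod.fst (ht i)).symm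
    have hb : b = y ∘ t := funext fun i => (congrArg Prod.snd (ht i)).symm
    rw [ha, hb, ← Language.Formula.realize_relabel, ← Language.Formula.realize_relabel]
    exact h _
  · rintro a ⟨b, hab⟩
    obtain ⟨i, hi⟩ := mem_ofGraph.1 hab
    exact ⟨i, congrArg Prod.fst hi⟩

/-! ### Saturation of rich models and elementarity of morphisms -/

namespace InductiveAmalgamationClass

variable (K : InductiveAmalgamationClass.{u} L)

/-- Morphisms from elementarily equivalent models into rich saturated models are elementary. -/
theorem isElementaryMap_of_isSaturated [Countable L.Symbols] {κ : Cardinal.{u}} (hκ : ℵ₀ ≤ κ)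
    {U M : Type u} [L.Structure U] [L.Structure M] (hU : K.IsCardinalRich κ U)
    (hsat : IsSaturated L κ U) (hMU : M ≅[L] U) {f : M ≃. U} (hf : K.IsMorphism f) :
    IsElementaryMap L f := by
  intro n φ a b hab
  obtain ⟨z, hz⟩ := hsat.exists_realize_iff hκ hMU a
  obtain ⟨g, hg, hgz, -⟩ := exists_elementaryMap_of_family z a fun φ => (hz φ).symm
  -- Going from `z` through `a` to `b` gives a morphism from the rich model `U` to itself.
  have hgf := K.comp (K.elementary hU.1 (K.isModel_dom hf) hg) hf
  rw [hz φ]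
  exact K.isElementaryMap_of_rich hκ hκ hU hU hgf n φ z b fun i =>
    (PEquiv.mem_trans _ _ _ _).2 ⟨a i, hgz i, hab i⟩

/-- All morphisms into rich models from elementarily equivalent models are elementary. -/
def MorphismsElementary : Prop :=
  ∀ (U M : Type u) [L.Structure U] [L.Structure M], K.IsRich U → (M ≅[L] U) →
    ∀ f : M ≃. U, K.IsMorphism f → IsElementaryMap L f

variable {K}

/-- The hypothesis covers rich models only; a `κ`-rich `U` is reduced to this case by embedding it
elementarily into a rich `V`. -/
theorem MorphismsElementary.isElementaryMap [Countable L.Symbols]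
    (inaccessibles : ∀ μ : Cardinal.{u}, ∃ θ : Cardinal.{u}, μ < θ ∧ θ.IsInaccessible)
    (H : K.MorphismsElementary) {κ : Cardinal.{u}} (hκ : ℵ₀ ≤ κ)
    {U M : Type u} [L.Structure U] [L.Structure M] (hU : K.IsCardinalRich κ U) (hMU : M ≅[L] U)
    {f : M ≃. U} (hf : K.IsMorphism f) : IsElementaryMap L f := by
  obtain ⟨V, _, e, he, hee, hV, -⟩ :=
    K.exists_rich_elementary_extension inaccessibles hκ hU ℵ₀
  have h := H V M hV (hMU.trans hee.elementarilyEquivalent) _ (K.comp hf he)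
  refine (h.trans hee.symm).mono fun a b hab => ?_
  exact (PEquiv.mem_trans _ _ _ _).2 ⟨e b, (PEquiv.mem_trans _ _ _ _).2 ⟨b, hab, rfl⟩,
    (PEquiv.mem_iff_mem _).2 rfl⟩

theorem MorphismsElementary.isSaturated [Countable L.Symbols]
    (inaccessibles : ∀ μ : Cardinal.{u}, ∃ θ : Cardinal.{u}, μ < θ ∧ θ.IsInaccessible)
    (H : K.MorphismsElementary) {κ : Cardinal.{u}} (hκ : ℵ₀ ≤ κ)
    {U : Type u} [L.Structure U] (hU : K.IsCardinalRich κ U) : IsSaturated L κ U := by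
  intro A hA n p hp
  have := K.infinite hU.1
  have hreal : ∀ (φ : L[[A]].Formula (Fin n)) (w : Fin n → U),
      Language.Formula.Realize (L := L) (α := A ⊕ Fin n)
        (Language.BoundedFormula.constantsVarsEquiv φ) (Sum.elim (fun a => (a : U)) w) ↔
        φ.Realize w := fun φ w => Language.BoundedFormula.realize_constantsVarsEquiv
  obtain ⟨M, _, v, hM, hv⟩ := exists_realize_of_finitelySatisfiable (U := U) (I := A ⊕ Fin n)
    ({ψ | ∃ φ ∈ p, Language.BoundedFormula.constantsVarsEquiv φ = ψ} ∪
      -- Adding all formulas true of `A` makes the map from the copy of `A` in `M` back to `A`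
      -- elementary.
      {ψ | ∃ φ : L.Formula A, φ.Realize (fun a => (a : U)) ∧ φ.relabel Sum.inl = ψ}) (by
      intro r hr hfin
      obtain ⟨w, hw⟩ := hp {φ ∈ p | Language.BoundedFormula.constantsVarsEquiv φ ∈ r}
        (fun φ h => h.1) (Set.Finite.subset (hfin.preimage
          Language.BoundedFormula.constantsVarsEquiv.injective.injOn) fun φ h => h.2)
      refine ⟨Sum.elim (fun a => (a : U)) w, fun ψ hψ => ?_⟩
      rcases hr hψ with ⟨φ, hφ, rfl⟩ | ⟨φ, hφ, rfl⟩
      · exact (hreal φ w).2 (hw φ ⟨hφ, hψ⟩)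
      · rw [Language.Formula.realize_relabel, Sum.elim_comp_inl]
        exact hφ)
    -- The size is chosen so that the map on the copy of `A` satisfies `|f| ≤ #A < #M ≤ κ`, as
    -- richness demands.
    (μ := max ℵ₀ (Order.succ #A)) (le_max_left _ _) (by
      rw [Cardinal.mk_sum, Cardinal.lift_id', Cardinal.mk_fin, Cardinal.lift_natCast]
      exact Cardinal.add_le_of_le (le_max_left _ _) ((Order.le_succ _).trans (le_max_right _ _))
        ((Cardinal.natCast_lt_aleph0).le.trans (le_max_left _ _)))
  have hA' : ∀ φ : L.Formula A, φ.Realize (fun a => v (Sum.inl a)) ↔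
      φ.Realize (fun a => (a : U)) := by
    have h₁ : ∀ φ : L.Formula A, φ.Realize (fun a => (a : U)) →
        φ.Realize (fun a => v (Sum.inl a)) := fun φ hφ => by
      have := hv _ (Or.inr ⟨φ, hφ, rfl⟩)
      rwa [Language.Formula.realize_relabel] at this
    refine fun φ => ⟨fun h => ?_, h₁ φ⟩
    by_contra hn
    exact h₁ φ.not hn h
  obtain ⟨f, hf, hfv, hdom⟩ := exists_elementaryMap_of_family _ _ hA'
  have hMU := hf.elementarilyEquivalent
  obtain ⟨h, hh, hht, hfh⟩ := hU.2 M f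
    (K.elementary (K.elementarilyEquivalent hU.1 hMU.symm) hU.1 hf) (by
      rw [hM]
      exact ((Cardinal.mk_le_mk_of_subset hdom).trans Cardinal.mk_range_le).trans_lt
        ((Order.lt_succ _).trans_le (le_max_right _ _)))
    (hM.trans_le (max_le hκ (Order.succ_le_of_lt hA)))
  obtain ⟨h, rfl⟩ := exists_eq_ofInjective hht
  let g : M ↪ₑ[L] U := (H.isElementaryMap inaccessibles hκ hU hMU hh).toElementaryEmbedding
  have hg : ∀ a : A, g (v (Sum.inl a)) = a := fun a =>
    (mem_ofInjective _ _ _).1 (hfh _ _ (hfv a))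
  refine ⟨fun i => g (v (Sum.inr i)), fun φ hφ => (hreal φ _).1 ?_⟩
  have := (g.map_formula _ v).2 (hv _ (Or.inl ⟨φ, hφ, rfl⟩))
  convert this using 1
  funext i
  rcases i with a | i
  · exact (hg a).symm
  · rfl

end InductiveAmalgamationClass

end AmalgamationClasses

/-! ### The equivalences -/

theorem theorem4p3 {L : FirstOrder.Language.{0, 0}} [Countable L.Symbols]
    (inaccessibles : ∀ μ : Cardinal.{u}, ∃ θ : Cardinal.{u}, μ < θ ∧ θ.IsInaccessible)
    (K : InductiveAmalgamationClass.{u} L) (κ : Cardinal.{u}) (hκ : ℵ₀ ≤ κ) :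
    List.TFAE
      [∀ (U : Type u) [L.Structure U], K.IsCardinalRich κ U → IsSaturated L κ U,
       ∀ (U : Type u) [L.Structure U], K.IsRich U → IsSaturated L #U U,
       ∀ (U : Type u) [L.Structure U] (M : L.Substructure U), K.IsRich U → (M ≅[L] U) →
         K.IsStrongSubmodel M → M.IsElementary,
       ∀ (U M : Type u) [L.Structure U] [L.Structure M], K.IsRich U → (M ≅[L] U) →
         ∀ f : M ≃. U, K.IsMorphism f → IsElementaryMap L f] := by
  have hinf : ∀ {U : Type u} [L.Structure U], K.IsRich U → ℵ₀ ≤ #U := fun hU =>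
    Cardinal.infinite_iff.1 (K.infinite hU.1)
  tfae_have 1 → 4 := by
    intro H U M _ _ hU hMU f hf
    -- `U` may have fewer than `κ` elements and so need not be `κ`-rich; a rich elementary extension
    -- of size at least `κ` is.
    obtain ⟨V, _, e, he, hee, hV, hκV⟩ :=
      K.exists_rich_elementary_extension inaccessibles (hinf hU) hU κ
    have hV' := hV.mono hκV
    have h := K.isElementaryMap_of_isSaturated hκ hV' (H V hV')
      (hMU.trans hee.elementarilyEquivalent) (K.comp hf he)
    refine (h.trans hee.symm).mono fun a b hab => ?_
    exact (PEquiv.mem_trans _ _ _ _).2 ⟨e b, (PEquiv.mem_trans _ _ _ _).2 ⟨b, hab, rfl⟩,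
      (PEquiv.mem_iff_mem _).2 rfl⟩
  tfae_have 2 → 4 := fun H U M _ _ hU hMU f hf =>
    K.isElementaryMap_of_isSaturated (hinf hU) hU (H U hU) hMU hf
  tfae_have 4 → 1 := fun H U _ hU =>
    InductiveAmalgamationClass.MorphismsElementary.isSaturated inaccessibles H hκ hU
  tfae_have 4 → 2 := fun H U _ hU =>
    InductiveAmalgamationClass.MorphismsElementary.isSaturated inaccessibles H (hinf hU) hU
  tfae_have 4 → 3 := fun H U _ M hU hMU hM n φ x =>
    (H U M hU hMU _ hM n φ x (Subtype.val ∘ x) fun i => rfl).symm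
  tfae_have 3 → 4 := by
    intro H U M _ _ hU hMU f hf
    obtain ⟨N, _, d, g, hd, hdt, hg, hgt, hle⟩ := K.amalgamation hf
    obtain ⟨V, _, e, he, hV, -⟩ := K.exists_rich_extension inaccessibles (K.isModel_cod hg) ℵ₀
    have hUV := K.isElementaryMap_of_rich (hinf hU) (hinf hV) hU hV (K.comp hd he)
    have hgV := K.comp hg he
    have hgVt : IsTotal (g.trans (ofInjective e)) := fun a => by
      obtain ⟨b, hb⟩ := hgt a
      exact ⟨e b, (PEquiv.mem_trans _ _ _ _).2 ⟨b, hb, rfl⟩⟩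
    obtain ⟨h, hh⟩ := exists_eq_ofInjective hgVt
    rw [hh] at hgV
    let E : M ↪[L] V := (K.isPartialEmbedding hgV).toEmbedding
    have hR := K.isMorphism_of_equiv (K.isModel_dom hf) E.equivRange
    have hRel := isElementaryMap_ofInjective E.equivRange.toElementaryEmbedding
    have hstrong : K.IsStrongSubmodel E.toHom.range := by
      refine K.restrict (K.comp (K.inverse hR) hgV) ?_
      rintro ⟨_, x, rfl⟩ b hb
      rw [mem_ofInjective] at hb
      exact (PEquiv.mem_trans _ _ _ _).2 ⟨x, (PEquiv.mem_iff_mem _).2 rfl,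
        (mem_ofInjective _ _ _).2 hb⟩
    -- Condition 3 is applied to the image of `M` in `V`, which is elementarily equivalent to `V`
    -- because `M ≡ U` and `U` embeds elementarily in `V`.
    have helem := H V E.toHom.range hV
      (hRel.elementarilyEquivalent.symm.trans (hMU.trans hUV.elementarilyEquivalent)) hstrong
    have hEl : IsElementaryMap L (ofInjective h) := by
      intro n φ a b hab
      have hb : b = Subtype.val ∘ (E.equivRange ∘ a) :=
        funext fun i => ((mem_ofInjective _ _ _).1 (hab i)).symm
      rw [hb, helem φ]
      exact (E.equivRange.toElementaryEmbedding.map_formula φ a).symm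
    refine (hEl.trans hUV.symm).mono fun a b hab => ?_
    obtain ⟨c, hc⟩ := hdt b
    refine (PEquiv.mem_trans _ _ _ _).2 ⟨e c, ?_, (PEquiv.mem_iff_mem _).2
      ((PEquiv.mem_trans _ _ _ _).2 ⟨c, hc, rfl⟩)⟩
    rw [← hh]
    exact (PEquiv.mem_trans _ _ _ _).2
      ⟨c, hle _ _ ((PEquiv.mem_trans _ _ _ _).2 ⟨b, hab, hc⟩), rfl⟩
  tfae_finish
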